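/- \textbf{Setting.} For $v,w\in\mathbb C^l$ put $\langle w\rangle=\frac1l\sum_i w_i$, $\langle v,w\rangle=\frac1l\sum_i\overline{v_i}w_i$, $\|w\|_\infty=\max_i|w_i|$; for an $l\times l$ matrix $T$ let $\|T\|_{\infty\to\infty}$ be its operator norm on $(\mathbb C^l,\|\cdot\|_\infty)$. Products, quotients, absolute values, imaginary parts and inequalities of vectors are entrywise, and $\mathbb H=\{z\in\mathbb C:\operatorname{Im}z>0\}$. A $K\times K$ matrix $Z=(z_{ij})$ with nonnegative entries is \emph{fully indecomposable} if for all nonempty $I,J\subset\{1,\dots,K\}$ with $\#I+\#J\ge K$ the submatrix $(z_{ij})_{i\in I,j\in J}$ has a nonzero entry. Let $p\ge1$ and let $S=(s_{ik})$ be a $p\times p$ matrix with nonnegative entries such that (A) $s_{ik}\le \frac{s_*}{2p}$ for all $i,k$; (F1) there are a fully indecomposable $K\times K$ matrix $Z=(z_{ij})$ with entries in $\{0,1\}$ and a partition $(I_i)_{i=1}^K$ of $\{1,\dots,p\}$ with $\#I_i=p/K$ and $s_{xy}\ge\frac{\varphi}{2p}z_{ij}$ for all $x\in I_i$, $y\in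 I_j$, $1\le i,j\le K$. Here $s_*,\varphi>0$ and $K\in\mathbb N$ are the model parameters. Let $\mathfrak S=\begin{pmatrix}0&S\\S^t&0\end{pmatrix}$ and, for $z\in\mathbb H$, let $\mathfrak M(z)\in\mathbb C^{2p}$ be the unique vector with $\operatorname{Im}\mathfrak M(z)>0$ and $-\frac1{\mathfrak M(z)}=z+\mathfrak S\mathfrak M(z)$. \textbf{Proposition.} There are constants $c,C,\widehat\delta,\lambda_*>0$, depending only on $s_*,\varphi,K$ (in particular not on $p$ or $S$), such that for all $p$ and $S$ as above the following holds. Put $\mathbb D=\{z\in\mathbb H:|z|\le10,\ |\operatorname{Re}z|\le\widehat\delta\}$. (i) For all $z\in\mathbb D$: $c\le|\mathfrak M_x(z)|\le C$ for every $x$, and $\langle\operatorname{Im}\mathfrak M(z)\rangle\ge c$. Moreover there is $\mathfrak v(0)\in\mathbb R^{2p}$ with $c\le\mathfrak v(0)\le C$ and $\lim_{\eta\downarrow0}\mathfrak M(\mathrm i\eta)=\mathrm i\,\mathfrak v(0)$. (ii) There is a function $T:\mathbb H\to\mathbb C^{2p\times2p}$, depending only on $S$, with $\|T(z)\|_{\infty\to\infty}\le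 C$ for all $z\in\mathbb H$, such that the following is true. Let $\mathfrak d:\mathbb H\to\mathbb C^{2p}$ and $\mathfrak g=(g_1,g_2):\mathbb H\to(\mathbb C\setminus\{0\})^{p+p}$ satisfy $-\frac1{\mathfrak g(z)}=z+\mathfrak S\mathfrak g(z)+\mathfrak d(z)$ and $\langle g_1(z)\rangle=\langle g_2(z)\rangle$ for all $z\in\mathbb H$. Then for every $z\in\mathbb D$ with $\|\mathfrak g(z)-\mathfrak M(z)\|_\infty\le\lambda_*$ we have $$\|\mathfrak g(z)-\mathfrak M(z)\|_\infty\le C\|\mathfrak d(z)\|_\infty$$ and, for all $w\in\mathbb C^{2p}$, $$|\langle w,\mathfrak g(z)-\mathfrak M(z)\rangle|\le C\bigl(\|w\|_\infty\|\mathfrak d(z)\|_\infty^2+|\langle T(z)w,\mathfrak d(z)\rangle|\bigr).$$ -/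

import Mathlib

open Filter Topology

namespace GramQVE

/-- Average `⟨w⟩ = l⁻¹ ∑ᵢ wᵢ` of a real or complex vector of length `l`. -/
noncomputable def avg {𝕜 : Type*} [RCLike 𝕜] {ι : Type*} [Fintype ι] (w : ι → 𝕜) : 𝕜 :=
  (Fintype.card ι : 𝕜)⁻¹ * ∑ i, w i

/-- Normalized scalar product `⟨v, w⟩ = l⁻¹ ∑ᵢ conj(vᵢ) wᵢ` on `ℂ^l`. -/
noncomputable def scalarProd {ι : Type*} [Fintype ι] (v w : ι → ℂ) : ℂ :=
  (Fintype.card ι : ℂ)⁻¹ * ∑ i, (starRingEnd ℂ) (v i) * w i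

/-- The norm `‖T‖_{∞→∞}` of a square matrix: the operator norm of `w ↦ T w` on `ℂ^l` with the
maximum norm (the norm that Mathlib puts on `ι → ℂ`). -/
noncomputable def infOpNorm {ι : Type*} [Fintype ι] [DecidableEq ι] (T : Matrix ι ι ℂ) : ℝ :=
  ‖LinearMap.toContinuousLinearMap (Matrix.toLin' T)‖

/-- The symmetrized matrix `((0, S), (Sᵗ, 0))` of a square matrix `S`. -/
def symmetrization {p : ℕ} (S : Matrix (Fin p) (Fin p) ℝ) :
    Matrix (Fin p ⊕ Fin p) (Fin p ⊕ Fin p) ℝ :=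
  Matrix.fromBlocks 0 S S.transpose 0

/-- Flatness of a `p × p` matrix: `s_{ik} ≤ s_* / (p + n)` with `n = p`. -/
def IsFlat {p : ℕ} (sstar : ℝ) (S : Matrix (Fin p) (Fin p) ℝ) : Prop :=
  ∀ i k, S i k ≤ sstar / ((p : ℝ) + p)

/-- A `K × K` matrix with nonnegative entries is fully indecomposable if every submatrix with
nonempty row set `I` and nonempty column set `J`, `#I + #J ≥ K`, has a nonzero entry. -/
def FullyIndecomposable {K : ℕ} (Z : Matrix (Fin K) (Fin K) ℝ) : Prop :=
  (∀ i j, 0 ≤ Z i j) ∧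
    ∀ I J : Finset (Fin K), I.Nonempty → J.Nonempty → K ≤ I.card + J.card →
      ∃ i ∈ I, ∃ j ∈ J, Z i j ≠ 0

/-- Block full indecomposability of a `p × p` matrix with parameters `φ` and `K`: there are a
fully indecomposable `0-1` matrix `Z` of size `K` and a partition of the index set into `K` blocks
`I i` of equal size `p / K` with `s_{xy} ≥ φ z_{ij} / (p + n)`, `n = p`, for `x ∈ I i`,
`y ∈ I j`. -/
def BlockFullyIndecomposable {p : ℕ} (φ : ℝ) (K : ℕ) (S : Matrix (Fin p) (Fin p) ℝ) : Prop :=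
  ∃ (Z : Matrix (Fin K) (Fin K) ℝ) (I : Fin K → Finset (Fin p)),
    FullyIndecomposable Z ∧
    (∀ i j, Z i j = 0 ∨ Z i j = 1) ∧
    (∀ x, ∃! i, x ∈ I i) ∧
    (∀ i, ((I i).card : ℝ) = (p : ℝ) / K) ∧
    ∀ i j, ∀ x ∈ I i, ∀ y ∈ I j, φ / ((p : ℝ) + p) * Z i j ≤ S x y

section QVE

variable {ι : Type*} [Fintype ι]

/-- The perturbed quadratic vector equation `-1/g = z + A g + d` for vectors `g, d`, at `z`. -/
def PerturbedQVE (A : Matrix ι ι ℝ) (z : ℂ) (g d : ι → ℂ) : Prop :=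
  ∀ x, -1 / g x = z + ∑ y, (A x y : ℂ) * g y + d x

/-- `u` solves the quadratic vector equation `-1/u = z + A u` at `z` and has positive imaginary
part. -/
def IsQVESolution (A : Matrix ι ι ℝ) (z : ℂ) (u : ι → ℂ) : Prop :=
  (∀ x, 0 < (u x).im) ∧ PerturbedQVE A z u 0

/-- The solution of the quadratic vector equation `-1/M(z) = z + A M(z)`, `Im M(z) > 0`, for
`Im z > 0`; it exists and is unique if `A` has nonnegative entries, see
`existsUnique_isQVESolution` and `isQVESolution_qveSolution`. -/
noncomputable def qveSolution (A : Matrix ι ι ℝ) (z : ℂ) : ι → ℂ :=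
  Classical.epsilon (IsQVESolution A z)

theorem im_affine (A : Matrix ι ι ℝ) (z : ℂ) (u : ι → ℂ) (x : ι) :
    (z + ∑ y, (A x y : ℂ) * u y).im = z.im + ∑ y, A x y * (u y).im := by
  simp

theorem im_neg_one_div (w : ℂ) : (-1 / w).im = w.im / ‖w‖ ^ 2 := by
  rw [← Complex.normSq_eq_norm_sq, neg_div, one_div, Complex.neg_im, Complex.inv_im]
  ring

theorem im_affine_ge {A : Matrix ι ι ℝ} (hA : ∀ x y, 0 ≤ A x y) {z : ℂ} {u : ι → ℂ}
    (hu : ∀ y, 0 < (u y).im) (x : ι) : z.im ≤ (z + ∑ y, (A x y : ℂ) * u y).im := by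
  rw [im_affine]
  have : 0 ≤ ∑ y, A x y * (u y).im :=
    Finset.sum_nonneg fun y _ => mul_nonneg (hA x y) (hu y).le
  linarith

theorem norm_step_le {A : Matrix ι ι ℝ} (hA : ∀ x y, 0 ≤ A x y) {z : ℂ} (hz : 0 < z.im)
    {u : ι → ℂ} (hu : ∀ y, 0 < (u y).im) (x : ι) :
    ‖-1 / (z + ∑ y, (A x y : ℂ) * u y)‖ ≤ 1 / z.im := by
  rw [norm_div, norm_neg, norm_one]
  refine one_div_le_one_div_of_le hz ((im_affine_ge hA hu x).trans ?_)
  exact (le_abs_self _).trans (Complex.abs_im_le_norm _)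

theorem im_step_pos {A : Matrix ι ι ℝ} (hA : ∀ x y, 0 ≤ A x y) {z : ℂ} (hz : 0 < z.im)
    {u : ι → ℂ} (hu : ∀ y, 0 < (u y).im) (x : ι) :
    0 < (-1 / (z + ∑ y, (A x y : ℂ) * u y)).im := by
  have h := im_affine_ge (z := z) hA hu x
  set w := z + ∑ y, (A x y : ℂ) * u y
  have hw : w ≠ 0 := by
    intro h0
    rw [h0, Complex.zero_im] at h
    linarith
  rw [im_neg_one_div]
  have := norm_pos_iff.2 hw
  have : 0 < w.im := lt_of_lt_of_le hz h
  positivity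

theorem exists_contraction {A : Matrix ι ι ℝ} (hA : ∀ x y, 0 ≤ A x y) {z : ℂ} (hz : 0 < z.im) :
    ∃ q : ℝ, 0 ≤ q ∧ q < 1 ∧ ∀ (a b : ι → ℂ) (D : ℝ), 0 ≤ D →
      (∀ y, 0 < (a y).im) → (∀ y, 0 < (b y).im) →
      (∀ y, (a y).im ≤ 1 / z.im) → (∀ y, (b y).im ≤ 1 / z.im) →
      (∀ y, ‖a y - b y‖ ^ 2 ≤ D * ((a y).im * (b y).im)) →
      ∀ x, ‖-1 / (z + ∑ y, (A x y : ℂ) * a y) - -1 / (z + ∑ y, (A x y : ℂ) * b y)‖ ^ 2 ≤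
        q ^ 2 * D * ((-1 / (z + ∑ y, (A x y : ℂ) * a y)).im *
          (-1 / (z + ∑ y, (A x y : ℂ) * b y)).im) := by
  set η := z.im with hη
  set t : ℝ := (∑ x, ∑ y, A x y) * (1 / η) with ht
  have hs : 0 ≤ ∑ x, ∑ y, A x y :=
    Finset.sum_nonneg fun x _ => Finset.sum_nonneg fun y _ => hA x y
  have ht0 : 0 ≤ t := by positivity
  have hden : 0 < η + t := by linarith
  have hP : ∀ u : ι → ℂ, (∀ y, 0 < (u y).im) → (∀ y, (u y).im ≤ 1 / η) → ∀ x,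
      ∑ y, A x y * (u y).im ≤ t / (η + t) * (η + ∑ y, A x y * (u y).im) := by
    intro u _ hu x
    have h1 : ∑ y, A x y * (u y).im ≤ t := by
      calc ∑ y, A x y * (u y).im ≤ ∑ y, A x y * (1 / η) :=
            Finset.sum_le_sum fun y _ => mul_le_mul_of_nonneg_left (hu y) (hA x y)
        _ = (∑ y, A x y) * (1 / η) := by rw [Finset.sum_mul]
        _ ≤ t := by
            refine mul_le_mul_of_nonneg_right ?_ (by positivity)
            exact Finset.single_le_sum (f := fun x => ∑ y, A x y)
              (fun x _ => Finset.sum_nonneg fun y _ => hA x y) (Finset.mem_univ x)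
    rw [div_mul_eq_mul_div, le_div_iff₀ hden]
    nlinarith [mul_le_mul_of_nonneg_left h1 hz.le]
  refine ⟨t / (η + t), by positivity, by rw [div_lt_one hden]; linarith, ?_⟩
  intro a b D hD ha hb ha' hb' hab x
  have ima := im_affine A z a x
  have imb := im_affine A z b x
  have gea := im_affine_ge (z := z) hA ha x
  have geb := im_affine_ge (z := z) hA hb x
  have hdiff : (z + ∑ y, (A x y : ℂ) * a y) - (z + ∑ y, (A x y : ℂ) * b y)
      = ∑ y, (A x y : ℂ) * (a y - b y) := by
    rw [add_sub_add_left_eq_sub, ← Finset.sum_sub_distrib]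
    exact Finset.sum_congr rfl fun y _ => by ring
  set w₁ := z + ∑ y, (A x y : ℂ) * a y
  set w₂ := z + ∑ y, (A x y : ℂ) * b y
  set P := ∑ y, A x y * (a y).im with hPdef
  set Q := ∑ y, A x y * (b y).im with hQdef
  set q := t / (η + t)
  have hP0 : 0 ≤ P := Finset.sum_nonneg fun y _ => mul_nonneg (hA x y) (ha y).le
  have hQ0 : 0 ≤ Q := Finset.sum_nonneg fun y _ => mul_nonneg (hA x y) (hb y).le
  have hPq : P ≤ q * w₁.im := by rw [ima]; exact hP a ha ha' x
  have hQq : Q ≤ q * w₂.im := by rw [imb]; exact hP b hb hb' x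
  have h1 : ‖w₁ - w₂‖ ^ 2 ≤ D * P * Q := by
    have hle : ‖w₁ - w₂‖ ≤ ∑ y, A x y * ‖a y - b y‖ := by
      rw [hdiff]
      refine (norm_sum_le _ _).trans (Finset.sum_le_sum fun y _ => ?_)
      rw [norm_mul, Complex.norm_real, Real.norm_eq_abs, abs_of_nonneg (hA x y)]
    calc ‖w₁ - w₂‖ ^ 2 ≤ (∑ y, A x y * ‖a y - b y‖) ^ 2 :=
          pow_le_pow_left₀ (norm_nonneg _) hle 2
      _ ≤ (∑ y, D * (A x y * (a y).im)) * ∑ y, A x y * (b y).im := by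
          refine Finset.sum_sq_le_sum_mul_sum_of_sq_le_mul _
            (fun y _ => mul_nonneg hD (mul_nonneg (hA x y) (ha y).le))
            (fun y _ => mul_nonneg (hA x y) (hb y).le) (fun y _ => ?_)
          have := mul_le_mul_of_nonneg_left (hab y) (sq_nonneg (A x y))
          nlinarith
      _ = D * P * Q := by rw [← Finset.mul_sum]
  have hw₁ : 0 < w₁.im := lt_of_lt_of_le hz gea
  have hw₂ : 0 < w₂.im := lt_of_lt_of_le hz geb
  have hw₁0 : w₁ ≠ 0 := fun h => by rw [h, Complex.zero_im] at hw₁; exact lt_irrefl _ hw₁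
  have hw₂0 : w₂ ≠ 0 := fun h => by rw [h, Complex.zero_im] at hw₂; exact lt_irrefl _ hw₂
  have n1 := norm_pos_iff.2 hw₁0
  have n2 := norm_pos_iff.2 hw₂0
  have h2 : ‖w₁ - w₂‖ ^ 2 ≤ q ^ 2 * D * (w₁.im * w₂.im) := by
    have : P * Q ≤ (q * w₁.im) * (q * w₂.im) :=
      mul_le_mul hPq hQq hQ0 (hP0.trans hPq)
    nlinarith [mul_le_mul_of_nonneg_left this hD]
  have e : -1 / w₁ - -1 / w₂ = (w₁ - w₂) / (w₁ * w₂) := by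
    field_simp
    ring
  rw [e, im_neg_one_div, im_neg_one_div, norm_div, norm_mul, div_pow, mul_pow,
    div_mul_div_comm, ← mul_div_assoc]
  gcongr

theorem IsQVESolution.eq_step {A : Matrix ι ι ℝ} {z : ℂ} {u : ι → ℂ} (h : IsQVESolution A z u)
    (x : ι) : u x = -1 / (z + ∑ y, (A x y : ℂ) * u y) := by
  have hx := h.2 x
  have h0 : u x ≠ 0 := fun h0 => by
    have := h.1 x
    rw [h0, Complex.zero_im] at this
    exact lt_irrefl _ this
  simp only [Pi.zero_apply, add_zero] at hx
  rw [← hx]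
  field_simp

theorem existsUnique_isQVESolution {A : Matrix ι ι ℝ} (hA : ∀ x y, 0 ≤ A x y) {z : ℂ}
    (hz : 0 < z.im) : ∃! u : ι → ℂ, IsQVESolution A z u := by
  obtain ⟨q, hq0, hq1, hq⟩ := exists_contraction hA hz
  have imle : ∀ c : ℂ, c.im ≤ ‖c‖ := fun c => (le_abs_self _).trans (Complex.abs_im_le_norm c)
  have crude : ∀ a b : ι → ℂ, (∀ y, 0 < (a y).im) → (∀ y, 0 < (b y).im) →
      ∃ D : ℝ, 0 ≤ D ∧ ∀ y, ‖a y - b y‖ ^ 2 ≤ D * ((a y).im * (b y).im) := by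
    intro a b ha hb
    have hn : ∀ y, 0 ≤ ‖a y - b y‖ ^ 2 / ((a y).im * (b y).im) := fun y => by
      have := ha y
      have := hb y
      positivity
    refine ⟨∑ y, ‖a y - b y‖ ^ 2 / ((a y).im * (b y).im), Finset.sum_nonneg fun y _ => hn y, ?_⟩
    intro y
    rw [← div_le_iff₀ (mul_pos (ha y) (hb y))]
    exact Finset.single_le_sum (f := fun y => ‖a y - b y‖ ^ 2 / ((a y).im * (b y).im))
      (fun y _ => hn y) (Finset.mem_univ y)
  set Φ : (ι → ℂ) → ι → ℂ := fun u x => -1 / (z + ∑ y, (A x y : ℂ) * u y) with hΦ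
  set u : ℕ → ι → ℂ := fun k => Φ^[k + 1] (fun _ => Complex.I) with hu
  have hsucc : ∀ k, u (k + 1) = Φ (u k) := fun k => by
    simp only [hu]
    rw [Function.iterate_succ_apply']
  have hpos : ∀ k y, 0 < (u k y).im := by
    intro k
    induction k with
    | zero => exact fun y => im_step_pos hA hz (fun _ => by simp) y
    | succ k ih => rw [hsucc]; exact fun y => im_step_pos hA hz ih y
  have hbd : ∀ k y, ‖u k y‖ ≤ 1 / z.im := by
    intro k
    cases k with
    | zero => exact fun y => norm_step_le hA hz (fun _ => by simp) y
    | succ k => rw [hsucc]; exact fun y => norm_step_le hA hz (hpos k) y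
  obtain ⟨D, hD, hD0⟩ := crude (u 0) (u 1) (hpos 0) (hpos 1)
  have hgeo : ∀ k y, ‖u k y - u (k + 1) y‖ ^ 2 ≤
      (q ^ 2) ^ k * D * ((u k y).im * (u (k + 1) y).im) := by
    intro k
    induction k with
    | zero => simpa using hD0
    | succ k ih =>
      have := hq (u k) (u (k + 1)) ((q ^ 2) ^ k * D) (by positivity) (hpos k) (hpos (k + 1))
        (fun y => (imle _).trans (hbd k y)) (fun y => (imle _).trans (hbd (k + 1) y)) ih
      intro x
      have hx := this x
      rw [hsucc (k + 1), pow_succ, hsucc k]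
      rw [hsucc k] at hx
      calc _ ≤ _ := hx
        _ = _ := by simp only [hΦ]; ring
  have hdist : ∀ k, dist (u k) (u (k + 1)) ≤ (Real.sqrt D * (1 / z.im)) * q ^ k := by
    intro k
    refine (dist_pi_le_iff (by positivity)).2 fun y => ?_
    rw [dist_eq_norm]
    refine abs_le_of_sq_le_sq' ?_ (by positivity) |>.2
    have h1 : (u k y).im * (u (k + 1) y).im ≤ (1 / z.im) * (1 / z.im) :=
      mul_le_mul ((imle _).trans (hbd k y)) ((imle _).trans (hbd (k + 1) y)) (hpos _ _).le
        (by positivity)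
    calc ‖u k y - u (k + 1) y‖ ^ 2 ≤ (q ^ 2) ^ k * D * ((u k y).im * (u (k + 1) y).im) := hgeo k y
      _ ≤ (q ^ 2) ^ k * D * ((1 / z.im) * (1 / z.im)) := by gcongr
      _ = (Real.sqrt D * (1 / z.im) * q ^ k) ^ 2 := by
          rw [mul_pow, mul_pow, Real.sq_sqrt hD]; ring
  clear_value u
  have hc : CauchySeq u := cauchySeq_of_le_geometric q _ hq1 hdist
  obtain ⟨m, hm⟩ := cauchySeq_tendsto_of_complete hc
  have hmx : ∀ x, Tendsto (fun k => u k x) atTop (𝓝 (m x)) := fun x => (tendsto_pi_nhds.1 hm) x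
  have him : ∀ x, 0 ≤ (m x).im := fun x =>
    ge_of_tendsto ((Complex.continuous_im.tendsto _).comp (hmx x))
      (Eventually.of_forall fun k => (hpos k x).le)
  have hwlim : ∀ x, Tendsto (fun k => z + ∑ y, (A x y : ℂ) * u k y) atTop
      (𝓝 (z + ∑ y, (A x y : ℂ) * m y)) := fun x =>
    tendsto_const_nhds.add (tendsto_finsetSum _ fun y _ => (hmx y).const_mul _)
  have hwim : ∀ x, z.im ≤ (z + ∑ y, (A x y : ℂ) * m y).im := fun x => by
    rw [im_affine]
    have : 0 ≤ ∑ y, A x y * (m y).im :=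
      Finset.sum_nonneg fun y _ => mul_nonneg (hA x y) (him y)
    linarith
  have hw0 : ∀ x, z + ∑ y, (A x y : ℂ) * m y ≠ 0 := fun x h => by
    have := hwim x
    rw [h, Complex.zero_im] at this
    linarith
  have hfix : ∀ x, m x = -1 / (z + ∑ y, (A x y : ℂ) * m y) := fun x => by
    have h1 : Tendsto (fun k => u (k + 1) x) atTop (𝓝 (m x)) :=
      (hmx x).comp (tendsto_add_atTop_nat 1)
    have h2 : Tendsto (fun k => u (k + 1) x) atTop (𝓝 (-1 / (z + ∑ y, (A x y : ℂ) * m y))) := by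
      simp only [hsucc]
      exact tendsto_const_nhds.div (hwlim x) (hw0 x)
    exact tendsto_nhds_unique h1 h2
  have hms : IsQVESolution A z m := by
    refine ⟨fun x => ?_, fun x => ?_⟩
    · rw [hfix x, im_neg_one_div]
      have h1 := norm_pos_iff.2 (hw0 x)
      have h2 := lt_of_lt_of_le hz (hwim x)
      exact div_pos h2 (pow_pos h1 2)
    · have h1 : -1 / m x = z + ∑ y, (A x y : ℂ) * m y :=
        (congrArg (fun c => -1 / c) (hfix x)).trans (by
          rw [div_div_eq_mul_div, neg_one_mul, div_neg, div_one, neg_neg])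
      simpa using h1
  refine ⟨m, hms, ?_⟩
  · intro m' hm'
    have bd : ∀ v : ι → ℂ, IsQVESolution A z v → ∀ y, (v y).im ≤ 1 / z.im := fun v hv y => by
      refine (imle _).trans ?_
      rw [hv.eq_step y]
      exact norm_step_le hA hz hv.1 y
    obtain ⟨E, hE, hE0⟩ := crude m' m hm'.1 hms.1
    have hk : ∀ k : ℕ, ∀ y, ‖m' y - m y‖ ^ 2 ≤ (q ^ 2) ^ k * E * ((m' y).im * (m y).im) := by
      intro k
      induction k with
      | zero => simpa using hE0
      | succ k ih =>
        intro x
        have := hq m' m ((q ^ 2) ^ k * E) (by positivity) hm'.1 hms.1 (bd _ hm') (bd _ hms) ih x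
        rw [← hm'.eq_step x, ← hms.eq_step x] at this
        calc _ ≤ _ := this
          _ = _ := by ring
    funext y
    have hlim : Tendsto (fun k : ℕ => (q ^ 2) ^ k * E * ((m' y).im * (m y).im)) atTop (𝓝 0) := by
      have := ((tendsto_pow_atTop_nhds_zero_of_lt_one (sq_nonneg q)
        (by nlinarith : q ^ 2 < 1)).mul_const E).mul_const ((m' y).im * (m y).im)
      simpa using this
    have h0 : ‖m' y - m y‖ ^ 2 ≤ 0 :=
      ge_of_tendsto hlim (Eventually.of_forall fun k => hk k y)
    have h1 : ‖m' y - m y‖ = 0 := by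
      have := norm_nonneg (m' y - m y)
      nlinarith
    exact sub_eq_zero.1 (norm_eq_zero.1 h1)

theorem isQVESolution_qveSolution {A : Matrix ι ι ℝ} (hA : ∀ x y, 0 ≤ A x y) {z : ℂ}
    (hz : 0 < z.im) : IsQVESolution A z (qveSolution A z) :=
  Classical.epsilon_spec (existsUnique_isQVESolution hA hz).exists

end QVE

theorem symmetrization_nonneg {p : ℕ} {S : Matrix (Fin p) (Fin p) ℝ} (hS : ∀ i k, 0 ≤ S i k)
    (x y : Fin p ⊕ Fin p) : 0 ≤ symmetrization S x y := by
  rcases x with i | i <;> rcases y with k | k <;> simp [symmetrization, hS]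

end GramQVE

open GramQVE

namespace GramQVE

/-! On the imaginary axis `𝔐 = i(v, w)` is purely imaginary, with `v (η + S w) = 1` and `w (η + Sᵗ
v) = 1`. The matrix `v_x S_xy w_y` is then almost doubly stochastic; full indecomposability of the
block pattern forbids a block of `v` with huge mass (`block_sum_lt`), and pointwise bounds
independent of `p` follow (`exists_imaginaryAxis_bounds`).

The linearization there is the real symmetric operator `1/v² + 𝔖`. Let `ε = (1, -1)`. Writing `h = ε
v w` for a new unknown `w`, its quadratic form dominates a Dirichlet energy of `w` (`energy_le`).
The block pattern defines a connected graph, so a Poincaré inequality bounds `w` up to a constant.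
The only nearly flat direction is thus `ε v`, which the operator maps to `η ε`; adding the rank one
term `ε ⟨ε, ·⟩` removes it (`exists_linear_stability`). This addition costs nothing: `⟨g₁⟩ = ⟨g₂⟩`,
and the same identity for `𝔐`, say exactly that the term vanishes on `g - 𝔐`
(`stabilityMatrix_mulVec_sub`).

The solution at `z` solves the equation at `i Im z` up to a constant perturbation, so stability and
a continuity argument carry the bounds to a strip of fixed width (`norm_qveSolution_sub_le`), and
the Lipschitz bound gives the limit at zero. In the strip, `g - 𝔐` satisfies a linear equation with
a quadratic remainder. Inverting it gives the norm bound; moving the inverse to the other side of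
the scalar product gives the refined bound (`exists_adjoint_inverse`). -/

theorem BlockFullyIndecomposable.exists_blockMap {p K : ℕ} {φ : ℝ}
    {S : Matrix (Fin p) (Fin p) ℝ} (h : BlockFullyIndecomposable φ K S) :
    ∃ (Z : Matrix (Fin K) (Fin K) ℝ) (b : Fin p → Fin K), FullyIndecomposable Z ∧
      (∀ i, ((Finset.univ.filter (b · = i)).card : ℝ) = (p : ℝ) / K) ∧
      ∀ x y, Z (b x) (b y) ≠ 0 → φ / ((p : ℝ) + p) ≤ S x y := by
  obtain ⟨Z, I, hZ, h01, hex, hcard, hlow⟩ := h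
  choose b hb hbu using hex
  have hfib : ∀ i, Finset.univ.filter (b · = i) = I i := fun i => by
    ext x
    simp only [Finset.mem_filter, Finset.mem_univ, true_and]
    exact ⟨fun h => h ▸ hb x, fun h => (hbu x i h).symm⟩
  refine ⟨Z, b, hZ, fun i => by rw [hfib, hcard], fun x y hxy => ?_⟩
  have := hlow (b x) (b y) x (hb x) y (hb y)
  rcases h01 (b x) (b y) with h | h
  · exact absurd h hxy
  · rwa [h, mul_one] at this

/-! ### Block sums and a gap between scales. -/

theorem sum_filter_mem_eq_sum_fiber {α β : Type*} [Fintype α] [DecidableEq β] (b : α → β)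
    (I : Finset β) (g : α → ℝ) :
    ∑ x with b x ∈ I, g x = ∑ i ∈ I, ∑ x with b x = i, g x := by
  rw [← Finset.sum_fiberwise_of_maps_to (s := Finset.univ.filter (b · ∈ I)) (t := I) (g := b)
    (fun x hx => (Finset.mem_filter.1 hx).2)]
  refine Finset.sum_congr rfl fun i hi => Finset.sum_congr ?_ fun _ _ => rfl
  ext x
  simp only [Finset.mem_filter, Finset.mem_univ, true_and, and_iff_right_iff_imp]
  rintro rfl
  exact hi

/-- Among `K` reals, none lies in at least one of the `K + 1` intervals `[R^(k+1), R^(k+2))`. -/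
theorem exists_scale_gap {K : ℕ} (a : Fin K → ℝ) {n R : ℝ} (hn : 0 < n) (hR : 1 ≤ R) :
    ∃ k ≤ K, ∀ i, a i < n * R ^ (k + 1) ∨ n * R ^ (k + 2) ≤ a i := by
  by_contra! hcon
  have hex : ∀ k : Fin (K + 1), ∃ i, n * R ^ ((k : ℕ) + 1) ≤ a i ∧ a i < n * R ^ ((k : ℕ) + 2) :=
    fun k => hcon k (Nat.lt_succ_iff.1 k.2)
  choose f hf1 hf2 using hex
  have key : ∀ k l : Fin (K + 1), k < l → f k ≠ f l := fun k l hkl heq => by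
    have h1 := hf2 k
    rw [heq] at h1
    have h2 : n * R ^ ((k : ℕ) + 2) ≤ n * R ^ ((l : ℕ) + 1) :=
      mul_le_mul_of_nonneg_left (pow_le_pow_right₀ hR (by have : (k : ℕ) < l := hkl; omega)) hn.le
    linarith [hf1 l]
  have hinj : Function.Injective f := fun k l h => by
    rcases lt_trichotomy k l with h' | h' | h'
    · exact absurd h (key k l h')
    · exact h'
    · exact absurd h.symm (key l k h')
  have := Fintype.card_le_of_injective f hinj
  simp at this

/-! ### A priori bounds on the imaginary axis. -/

section ImaginaryAxis

variable {p K : ℕ} {S : Matrix (Fin p) (Fin p) ℝ} {s φ η : ℝ}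
  {Z : Matrix (Fin K) (Fin K) ℝ} {b : Fin p → Fin K} {v w : Fin p → ℝ}

/-- For `x` in block `i`, keeping only block `j` in the equation gives `v x * (φ / 2p) * β ≤ 1`,
where `β` is the mass of `w` on block `j`. Summation over the `p / K` elements of block `i` gives
the bound. -/
theorem block_sum_mul_le (hp : 0 < p) (hK : 0 < K) (hφ : 0 < φ) (hη : 0 < η)
    (hS : ∀ i k, 0 ≤ S i k)
    (hcard : ∀ i, ((Finset.univ.filter (b · = i)).card : ℝ) = (p : ℝ) / K)
    (hlow : ∀ x y, Z (b x) (b y) ≠ 0 → φ / ((p : ℝ) + p) ≤ S x y)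
    (hv : ∀ x, 0 < v x) (hw : ∀ x, 0 < w x)
    (hvw : ∀ x, v x * (η + ∑ y, S x y * w y) = 1) {i j : Fin K} (hij : Z i j ≠ 0) :
    (∑ x with b x = i, v x) * (∑ y with b y = j, w y) ≤ 2 * K / φ * ((p : ℝ) / K) ^ 2 := by
  have hp' : (0 : ℝ) < p := by exact_mod_cast hp
  have hK' : (0 : ℝ) < K := by exact_mod_cast hK
  set β := ∑ y with b y = j, w y
  have h1 : ∀ x, b x = i → v x * (φ / ((p : ℝ) + p) * β) ≤ 1 := fun x hx => by
    have h2 : φ / ((p : ℝ) + p) * β ≤ ∑ y, S x y * w y := by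
      rw [Finset.mul_sum]
      calc _ ≤ ∑ y with b y = j, S x y * w y := by
            refine Finset.sum_le_sum fun y hy => mul_le_mul_of_nonneg_right ?_ (hw y).le
            refine hlow x y ?_
            rw [hx, (Finset.mem_filter.1 hy).2]
            exact hij
        _ ≤ _ := Finset.sum_le_sum_of_subset_of_nonneg (Finset.filter_subset _ _)
            fun y _ _ => mul_nonneg (hS x y) (hw y).le
    rw [← hvw x]
    exact mul_le_mul_of_nonneg_left (by linarith) (hv x).le
  have h2 : (∑ x with b x = i, v x) * (φ / ((p : ℝ) + p) * β) ≤ (p : ℝ) / K := by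
    rw [Finset.sum_mul, ← hcard i]
    calc _ ≤ ∑ x with b x = i, (1 : ℝ) :=
          Finset.sum_le_sum fun x hx => h1 x (Finset.mem_filter.1 hx).2
      _ = _ := by simp
  have e1 : (∑ x with b x = i, v x) * β =
      ((∑ x with b x = i, v x) * (φ / ((p : ℝ) + p) * β)) * ((p + p) / φ) := by
    field_simp
  have e2 : 2 * K / φ * ((p : ℝ) / K) ^ 2 = (p : ℝ) / K * ((p + p) / φ) := by
    field_simp
    ring
  rw [e1, e2]
  exact mul_le_mul_of_nonneg_right h2 (by positivity)

/-- Summing either family of equations gives `p`, and both contain the same bilinear sum `∑ v_x S_xy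
w_y`; what remains is multiplied by `η ≠ 0`. -/
theorem sum_eq_sum_of_dual (hη : 0 < η)
    (hvw : ∀ x, v x * (η + ∑ y, S x y * w y) = 1)
    (hwv : ∀ y, w y * (η + ∑ x, S x y * v x) = 1) : ∑ x, v x = ∑ y, w y := by
  have h1 : ∑ x, v x * (η + ∑ y, S x y * w y) = ∑ y, w y * (η + ∑ x, S x y * v x) := by
    simp [hvw, hwv]
  simp only [mul_add, Finset.sum_add_distrib, Finset.mul_sum] at h1
  rw [Finset.sum_comm (f := fun y x => w y * (S x y * v x)), ← Finset.sum_mul, ← Finset.sum_mul]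
    at h1
  have h2 : ∑ x, ∑ y, v x * (S x y * w y) = ∑ x, ∑ y, w y * (S x y * v x) :=
    Finset.sum_congr rfl fun x _ => Finset.sum_congr rfl fun y _ => by ring
  rw [h2] at h1
  exact mul_right_cancel₀ hη.ne' (by linarith)

/-- The weights `v_x S_xy w_y` have row sums `1 - η v_x` and column sums `1 - η w_y`. The mass of
the rows in `Xᶜ` is split by columns: the part in `Y` is at most the full columns, the part in `Yᶜ`
is controlled by flatness. -/
theorem mass_le (hS : ∀ i k, 0 ≤ S i k) (hflat : IsFlat s S)
    (hv : ∀ x, 0 < v x) (hw : ∀ x, 0 < w x)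
    (hvw : ∀ x, v x * (η + ∑ y, S x y * w y) = 1)
    (hwv : ∀ y, w y * (η + ∑ x, S x y * v x) = 1) (X Y : Finset (Fin p)) :
    ∑ x ∈ Xᶜ, (1 - η * v x) ≤ ∑ y ∈ Y, (1 - η * w y) +
      s / ((p : ℝ) + p) * ((∑ x ∈ Xᶜ, v x) * ∑ y ∈ Yᶜ, w y) := by
  have hrow : ∀ x, 1 - η * v x = ∑ y, v x * S x y * w y := fun x => by
    rw [← hvw x, mul_add, Finset.mul_sum]
    simp only [mul_assoc]
    ring
  have hcol : ∀ y, 1 - η * w y = ∑ x, v x * S x y * w y := fun y => by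
    rw [← hwv y, mul_add, Finset.mul_sum]
    have : ∑ x, v x * S x y * w y = ∑ x, w y * (S x y * v x) :=
      Finset.sum_congr rfl fun x _ => by ring
    rw [this]
    ring
  have hP : ∀ x y, 0 ≤ v x * S x y * w y := fun x y =>
    mul_nonneg (mul_nonneg (hv x).le (hS x y)) (hw y).le
  calc ∑ x ∈ Xᶜ, (1 - η * v x)
      = ∑ x ∈ Xᶜ, ∑ y ∈ Y, v x * S x y * w y + ∑ x ∈ Xᶜ, ∑ y ∈ Yᶜ, v x * S x y * w y := by
        rw [← Finset.sum_add_distrib]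
        exact Finset.sum_congr rfl fun x _ => by rw [hrow, Finset.sum_add_sum_compl]
    _ ≤ _ := by
        refine add_le_add ?_ ?_
        · rw [Finset.sum_comm]
          refine Finset.sum_le_sum fun y _ => ?_
          rw [hcol]
          exact Finset.sum_le_sum_of_subset_of_nonneg (Finset.subset_univ _) fun x _ _ => hP x y
        · rw [Finset.sum_mul_sum, Finset.mul_sum]
          refine Finset.sum_le_sum fun x _ => ?_
          rw [Finset.mul_sum]
          refine Finset.sum_le_sum fun y _ => ?_
          have := mul_le_mul_of_nonneg_left (hflat x y) (mul_pos (hv x) (hw y)).le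
          linarith

/-- If some block sum of `v` were huge, the blocks would split at a gap in scales into large ones
`I` and much smaller ones. With `J` the blocks where `w` is not small, `Z` vanishes on `I × J`, so
`#I + #J < K`. But the rows outside `I` send almost no mass outside the columns `J`, and near double
stochasticity forces `K - #I ≤ #J` up to an error less than one block. -/
theorem block_sum_lt (hp : 0 < p) (hK : 0 < K) (hs : 0 < s) (hφ : 0 < φ) (hη : 0 < η)
    (hη' : η ≤ 10) (hS : ∀ i k, 0 ≤ S i k) (hflat : IsFlat s S) (hZ : FullyIndecomposable Z)
    (hcard : ∀ i, ((Finset.univ.filter (b · = i)).card : ℝ) = (p : ℝ) / K)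
    (hlow : ∀ x y, Z (b x) (b y) ≠ 0 → φ / ((p : ℝ) + p) ≤ S x y)
    (hv : ∀ x, 0 < v x) (hw : ∀ x, 0 < w x)
    (hvw : ∀ x, v x * (η + ∑ y, S x y * w y) = 1)
    (hwv : ∀ y, w y * (η + ∑ x, S x y * v x) = 1) (i : Fin K) :
    ∑ x with b x = i, v x < (p : ℝ) / K * (1 + K * (11 + s / 2) * (2 * K / φ)) ^ (K + 2) := by
  have hp' : (0 : ℝ) < p := by exact_mod_cast hp
  have hK' : (0 : ℝ) < K := by exact_mod_cast hK
  by_contra! hi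
  set C₀ : ℝ := 2 * K / φ with hC₀
  -- In `11 + s / 2`, the `10` pays for the terms with `η ≤ 10`, `s / 2` pays for flatness, and the
  -- remaining `1` makes `K * C₀ < R` and the final contradiction strict.
  set R : ℝ := 1 + K * (11 + s / 2) * C₀ with hR
  set n : ℝ := (p : ℝ) / K with hn
  have hn0 : 0 < n := by positivity
  have hC₀0 : 0 < C₀ := by positivity
  have hR1 : 1 ≤ R := by
    have : 0 ≤ K * (11 + s / 2) * C₀ := by positivity
    linarith
  set a : Fin K → ℝ := fun i => ∑ x with b x = i, v x with ha
  set β : Fin K → ℝ := fun j => ∑ y with b y = j, w y with hβ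
  have hprod : ∀ i j, Z i j ≠ 0 → a i * β j ≤ C₀ * n ^ 2 := fun i j hij =>
    block_sum_mul_le hp hK hφ hη hS hcard hlow hv hw hvw hij
  have hapos : ∀ i, 0 ≤ a i := fun i => Finset.sum_nonneg fun x _ => (hv x).le
  have hsum : ∑ i, a i = ∑ j, β j := by
    simp only [ha, hβ, Finset.sum_fiberwise]
    exact sum_eq_sum_of_dual hη hvw hwv
  obtain ⟨k, hk, hgap⟩ := exists_scale_gap a hn0 hR1
  set τ := R ^ (k + 2) with hτ
  have hτR : R ≤ τ := le_self_pow₀ hR1 (by omega)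
  have hτ0 : 0 < τ := by linarith
  have hiτ : n * τ ≤ a i :=
    (mul_le_mul_of_nonneg_left (pow_le_pow_right₀ hR1 (by omega)) hn0.le).trans hi
  set I := Finset.univ.filter fun i => n * τ ≤ a i with hI
  -- The two thresholds multiply to `C₀ * n ^ 2`, the bound of `hprod`, so a nonzero entry of `Z` in
  -- `I × J` is impossible.
  set J := Finset.univ.filter fun j => C₀ * n / τ < β j with hJ
  have hIne : I.Nonempty := ⟨i, by simp [hI, hiτ]⟩
  have hKC : K * C₀ < R := by
    have : 0 ≤ K * (10 + s / 2) * C₀ := by positivity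
    rw [hR]
    linarith
  have hJc : ∀ j ∉ J, β j ≤ C₀ * n / τ := fun j hj => by simpa [hJ] using hj
  have hJne : J.Nonempty := by
    by_contra hJe
    rw [Finset.not_nonempty_iff_eq_empty] at hJe
    have h1 : ∑ j, β j ≤ K * (C₀ * n / τ) := by
      calc _ ≤ ∑ j : Fin K, C₀ * n / τ :=
            Finset.sum_le_sum fun j _ => hJc j (by simp [hJe])
        _ = _ := by simp
    have h2 : a i ≤ ∑ i, a i := Finset.single_le_sum (fun i _ => hapos i) (Finset.mem_univ i)
    have h3 : n * τ ≤ K * (C₀ * n / τ) := by linarith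
    have h4 : K * (C₀ * n / τ) = n * (K * C₀ / τ) := by ring
    rw [h4] at h3
    have h5 := le_of_mul_le_mul_left h3 hn0
    rw [le_div_iff₀ hτ0] at h5
    nlinarith
  have hIJ : I.card + J.card < K := by
    by_contra! hle
    obtain ⟨i, hi, j, hj, hij⟩ := hZ.2 I J hIne hJne hle
    have h1 := hprod i j hij
    have hi' : n * τ ≤ a i := (Finset.mem_filter.1 hi).2
    have hj' : C₀ * n / τ < β j := (Finset.mem_filter.1 hj).2
    have h2 : n * τ * (C₀ * n / τ) < a i * β j :=
      mul_lt_mul' hi' hj' (by positivity) (lt_of_lt_of_le (by positivity) hi')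
    have h3 : n * τ * (C₀ * n / τ) = C₀ * n ^ 2 := by
      field_simp
    linarith
  set X := Finset.univ.filter (b · ∈ I) with hX
  set Y := Finset.univ.filter (b · ∈ J) with hY
  have hXc : Xᶜ = Finset.univ.filter (b · ∈ Iᶜ) := by
    ext x; simp [hX]
  have hYc : Yᶜ = Finset.univ.filter (b · ∈ Jᶜ) := by
    ext x; simp [hY]
  have hmass := mass_le hS hflat hv hw hvw hwv X Y
  have hXcard : ((X.card : ℕ) : ℝ) = I.card * n := by
    have := sum_filter_mem_eq_sum_fiber b I (fun _ => (1 : ℝ))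
    simpa [hcard] using this
  have hYcard : ((Y.card : ℕ) : ℝ) = J.card * n := by
    have := sum_filter_mem_eq_sum_fiber b J (fun _ => (1 : ℝ))
    simpa [hcard] using this
  have hXccard : ((Xᶜ.card : ℕ) : ℝ) = p - I.card * n := by
    have := Finset.card_add_card_compl X
    rw [Fintype.card_fin] at this
    have : (X.card : ℝ) + Xᶜ.card = p := by exact_mod_cast this
    linarith
  have hvs : ∑ x ∈ Xᶜ, v x ≤ p * R ^ (k + 1) := by
    rw [hXc, sum_filter_mem_eq_sum_fiber]
    calc ∑ i ∈ Iᶜ, a i ≤ ∑ i ∈ Iᶜ, n * R ^ (k + 1) := by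
          refine Finset.sum_le_sum fun i hi => ?_
          rcases hgap i with h | h
          · exact h.le
          · simp [hI] at hi; linarith
      _ ≤ ∑ i : Fin K, n * R ^ (k + 1) :=
          Finset.sum_le_sum_of_subset_of_nonneg (Finset.subset_univ _) fun _ _ _ => by positivity
      _ = _ := by simp [hn]; field_simp
  have hws : ∑ y ∈ Yᶜ, w y ≤ p * (C₀ / τ) := by
    rw [hYc, sum_filter_mem_eq_sum_fiber]
    calc ∑ j ∈ Jᶜ, β j ≤ ∑ j ∈ Jᶜ, C₀ * n / τ :=
          Finset.sum_le_sum fun j hj => hJc j (Finset.mem_compl.1 hj)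
      _ ≤ ∑ j : Fin K, C₀ * n / τ :=
          Finset.sum_le_sum_of_subset_of_nonneg (Finset.subset_univ _) fun _ _ _ => by positivity
      _ = _ := by simp [hn]; field_simp
  have hsum' : ∑ x ∈ X, v x + ∑ x ∈ Xᶜ, v x = ∑ y ∈ Y, w y + ∑ y ∈ Yᶜ, w y := by
    rw [Finset.sum_add_sum_compl, Finset.sum_add_sum_compl]
    exact sum_eq_sum_of_dual hη hvw hwv
  have hX0 : 0 ≤ ∑ x ∈ X, v x := Finset.sum_nonneg fun x _ => (hv x).le
  have hYc0 : 0 ≤ ∑ y ∈ Yᶜ, w y := Finset.sum_nonneg fun x _ => (hw x).le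
  -- The gap is used here: `v` is below scale `R ^ (k + 1)` on `Xᶜ`, while `w` is of order `1 / R ^
  -- (k + 2)` on `Yᶜ`, which leaves a factor `1 / R`.
  have hlast : s / ((p : ℝ) + p) * ((∑ x ∈ Xᶜ, v x) * ∑ y ∈ Yᶜ, w y) ≤ p * (s / 2 * C₀ / R) := by
    calc _ ≤ s / ((p : ℝ) + p) * ((p * R ^ (k + 1)) * (p * (C₀ / τ))) := by
          gcongr
      _ = _ := by
          rw [hτ, pow_succ R (k + 1)]
          have : R ≠ 0 := by positivity
          field_simp
          ring
  simp only [Finset.sum_sub_distrib, Finset.sum_const, nsmul_eq_mul, mul_one, ← Finset.mul_sum,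
    hXccard, hYcard] at hmass
  have hη1 : η * ∑ y ∈ Yᶜ, w y ≤ 10 * (p * (C₀ / R)) := by
    have : C₀ / τ ≤ C₀ / R := by gcongr
    calc η * ∑ y ∈ Yᶜ, w y ≤ 10 * (p * (C₀ / τ)) := mul_le_mul hη' hws hYc0 (by norm_num)
      _ ≤ _ := by gcongr
  have hη2 : 0 ≤ η * ∑ x ∈ X, v x := mul_nonneg hη.le hX0
  -- The term `η * ∑ x ∈ Xᶜ, v x` has no small bound of its own. Equality of the total masses trades
  -- its excess over the sum on `Y` for the sum on `Yᶜ`, which is small.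
  have hηs : η * ∑ x ∈ X, v x + η * ∑ x ∈ Xᶜ, v x = η * ∑ y ∈ Y, w y + η * ∑ y ∈ Yᶜ, w y := by
    rw [← mul_add, hsum', mul_add]
  have hIJ' : (I.card : ℝ) + J.card + 1 ≤ K := by exact_mod_cast hIJ
  have hpn : (p : ℝ) = K * n := by rw [hn]; field_simp
  have h1 : n ≤ p * ((10 + s / 2) * C₀ / R) := by
    have e : p * ((10 + s / 2) * C₀ / R) = 10 * (p * (C₀ / R)) + p * (s / 2 * C₀ / R) := by ring
    have : ((I.card : ℝ) + J.card + 1) * n ≤ p := by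
      rw [hpn]; exact mul_le_mul_of_nonneg_right hIJ' hn0.le
    rw [e]
    linarith
  have h2 : p * ((10 + s / 2) * C₀ / R) = n * (K * (10 + s / 2) * C₀ / R) := by
    rw [hpn]; ring
  rw [h2] at h1
  have h3 : 1 ≤ K * (10 + s / 2) * C₀ / R := by
    by_contra! hlt
    nlinarith
  rw [le_div_iff₀ (by linarith)] at h3
  have : 0 < K * C₀ := by positivity
  rw [hR] at h3
  linarith

end ImaginaryAxis

/-- On the imaginary axis the solution is bounded from above and below, uniformly in the
dimension. -/
theorem exists_imaginaryAxis_bounds {s φ : ℝ} (hs : 0 < s) (hφ : 0 < φ) {K : ℕ} (hK : 0 < K) :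
    ∃ c C : ℝ, 0 < c ∧ 0 < C ∧ ∀ (p : ℕ) (S : Matrix (Fin p) (Fin p) ℝ)
      (Z : Matrix (Fin K) (Fin K) ℝ) (b : Fin p → Fin K) (η : ℝ) (v w : Fin p → ℝ), 0 < p →
      (∀ i k, 0 ≤ S i k) → IsFlat s S → FullyIndecomposable Z →
      (∀ i, ((Finset.univ.filter (b · = i)).card : ℝ) = (p : ℝ) / K) →
      (∀ x y, Z (b x) (b y) ≠ 0 → φ / ((p : ℝ) + p) ≤ S x y) → 0 < η → η ≤ 10 →
      (∀ x, 0 < v x) → (∀ x, 0 < w x) →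
      (∀ x, v x * (η + ∑ y, S x y * w y) = 1) →
      (∀ y, w y * (η + ∑ x, S x y * v x) = 1) →
      (∀ x, c ≤ v x ∧ v x ≤ C) ∧ ∀ x, c ≤ w x ∧ w x ≤ C := by
  have hK' : (0 : ℝ) < K := by exact_mod_cast hK
  set Λ : ℝ := (1 + K * (11 + s / 2) * (2 * K / φ)) ^ (K + 2) with hΛ
  have hΛ0 : 0 < Λ := by positivity
  set c : ℝ := 1 / (10 + s / 2 * Λ) with hc
  have hc0 : 0 < c := by positivity
  refine ⟨c, 2 * K / (φ * c), hc0, by positivity, ?_⟩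
  intro p S Z b η v w hp hS hflat hZ hcard hlow hη hη' hv hw hvw hwv
  have hp' : (0 : ℝ) < p := by exact_mod_cast hp
  have hsv : ∑ x, v x ≤ p * Λ := by
    rw [← Finset.sum_fiberwise Finset.univ b v]
    calc _ ≤ ∑ i : Fin K, (p : ℝ) / K * Λ := Finset.sum_le_sum fun i _ =>
          (block_sum_lt hp hK hs hφ hη hη' hS hflat hZ hcard hlow hv hw hvw hwv i).le
      _ = _ := by simp; field_simp
  have hsw : ∑ x, w x ≤ p * Λ := by rwa [← sum_eq_sum_of_dual hη hvw hwv]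
  -- The vector `r` stands for a row or a column of `S`, so that `lower` and `upper` serve both `v`
  -- and `w`. A bound on the total mass and flatness give the lower bound; the lower bound on one
  -- linked block then gives the upper one.
  have lower : ∀ (r : Fin p → ℝ) (u : Fin p → ℝ) (t : ℝ), (∀ y, r y ≤ s / ((p : ℝ) + p)) →
      (∀ y, 0 ≤ r y) → (∀ y, 0 < u y) → ∑ y, u y ≤ p * Λ → t * (η + ∑ y, r y * u y) = 1 →
      c ≤ t := by
    intro r u t hr hr0 hu hus ht
    have h0 : 0 ≤ ∑ y, r y * u y := Finset.sum_nonneg fun y _ => mul_nonneg (hr0 y) (hu y).le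
    have h1 : ∑ y, r y * u y ≤ s / 2 * Λ := by
      calc _ ≤ ∑ y, s / ((p : ℝ) + p) * u y :=
            Finset.sum_le_sum fun y _ => mul_le_mul_of_nonneg_right (hr y) (hu y).le
        _ ≤ s / ((p : ℝ) + p) * (p * Λ) := by rw [← Finset.mul_sum]; gcongr
        _ = _ := by field_simp; ring
    rw [← eq_div_iff (by positivity)] at ht
    rw [ht, hc]
    exact one_div_le_one_div_of_le (by positivity) (by linarith)
  have hvl : ∀ x, c ≤ v x := fun x =>
    lower (fun y => S x y) w (v x) (hflat x) (hS x) hw hsw (hvw x)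
  have hwl : ∀ x, c ≤ w x := fun y =>
    lower (fun x => S x y) v (w y) (fun x => hflat x y) (fun x => hS x y) hv hsv (hwv y)
  have upper : ∀ (r : Fin p → ℝ) (u : Fin p → ℝ) (t : ℝ) (j : Fin K),
      (∀ y, b y = j → φ / ((p : ℝ) + p) ≤ r y) → (∀ y, 0 ≤ r y) → (∀ y, c ≤ u y) → 0 < t →
      t * (η + ∑ y, r y * u y) = 1 → t ≤ 2 * K / (φ * c) := by
    intro r u t j hr hr0 hu ht0 ht
    have h1 : φ * c / (2 * K) ≤ ∑ y, r y * u y := by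
      calc φ * c / (2 * K) = ∑ y with b y = j, φ / ((p : ℝ) + p) * c := by
            rw [Finset.sum_const, nsmul_eq_mul, hcard]
            field_simp
            ring
        _ ≤ ∑ y with b y = j, r y * u y := Finset.sum_le_sum fun y hy =>
            mul_le_mul (hr y (Finset.mem_filter.1 hy).2) (hu y) hc0.le (hr0 y)
        _ ≤ _ := Finset.sum_le_sum_of_subset_of_nonneg (Finset.filter_subset _ _)
            fun y _ _ => mul_nonneg (hr0 y) (hc0.le.trans (hu y))
    have h2 : t * (φ * c / (2 * K)) ≤ 1 := by
      rw [← ht]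
      exact mul_le_mul_of_nonneg_left (by linarith) ht0.le
    rw [le_div_iff₀ (by positivity)]
    have h3 : t * (φ * c / (2 * K)) = t * (φ * c) / (2 * K) := by ring
    rwa [h3, div_le_one (by positivity)] at h2
  refine ⟨fun x => ⟨hvl x, ?_⟩, fun y => ⟨hwl y, ?_⟩⟩
  · obtain ⟨i, hi, j, _, hij⟩ := hZ.2 {b x} Finset.univ (by simp) ⟨b x, Finset.mem_univ _⟩ (by simp)
    rw [Finset.mem_singleton.1 hi] at hij
    exact upper (fun y => S x y) w (v x) j (fun y hy => hlow x y (hy ▸ hij)) (hS x) hwl (hv x)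
      (hvw x)
  · obtain ⟨i, _, j, hj, hij⟩ := hZ.2 Finset.univ {b y} ⟨b y, Finset.mem_univ _⟩ (by simp) (by simp)
    rw [Finset.mem_singleton.1 hj] at hij
    exact upper (fun x => S x y) v (w y) i (fun x hx => hlow x y (hx ▸ hij)) (fun x => hS x y) hvl
      (hw y) (hwv y)

/-! ### Connectedness of the block graph. -/

theorem FullyIndecomposable.eq_univ {K : ℕ} {Z : Matrix (Fin K) (Fin K) ℝ}
    (hZ : FullyIndecomposable Z) {I J : Finset (Fin K)}
    (hIJ : ∀ i j, Z i j ≠ 0 → (i ∈ I ↔ j ∈ J)) (hne : I.Nonempty ∨ J.Nonempty) :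
    I = Finset.univ ∧ J = Finset.univ := by
  have hrow : ∀ i, ∃ j, Z i j ≠ 0 := fun i => by
    obtain ⟨i', hi, j, _, hij⟩ := hZ.2 {i} Finset.univ (by simp) ⟨i, Finset.mem_univ _⟩ (by simp)
    rw [Finset.mem_singleton.1 hi] at hij
    exact ⟨j, hij⟩
  have hcol : ∀ j, ∃ i, Z i j ≠ 0 := fun j => by
    obtain ⟨i, _, j', hj, hij⟩ := hZ.2 Finset.univ {j} ⟨j, Finset.mem_univ _⟩ (by simp) (by simp)
    rw [Finset.mem_singleton.1 hj] at hij
    exact ⟨i, hij⟩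
  have hI : I.Nonempty := by
    rcases hne with h | ⟨j, hj⟩
    · exact h
    · obtain ⟨i, hi⟩ := hcol j
      exact ⟨i, (hIJ i j hi).2 hj⟩
  have hJ : J.Nonempty := by
    obtain ⟨i, hi⟩ := hI
    obtain ⟨j, hj⟩ := hrow i
    exact ⟨j, (hIJ i j hj).1 hi⟩
  -- The submatrices `I × Jᶜ` and `Iᶜ × J` vanish. Were both complements nonempty, full
  -- indecomposability would give both `#I < #J` and `#J < #I`.
  have h1 : Jᶜ.Nonempty → I.card + Jᶜ.card < K := fun hJc => by
    by_contra! h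
    obtain ⟨i, hi, j, hj, hij⟩ := hZ.2 I Jᶜ hI hJc h
    exact Finset.mem_compl.1 hj ((hIJ i j hij).1 hi)
  have h2 : Iᶜ.Nonempty → Iᶜ.card + J.card < K := fun hIc => by
    by_contra! h
    obtain ⟨i, hi, j, hj, hij⟩ := hZ.2 Iᶜ J hIc hJ h
    exact Finset.mem_compl.1 hi ((hIJ i j hij).2 hj)
  have hcI := Finset.card_add_card_compl I
  have hcJ := Finset.card_add_card_compl J
  rw [Fintype.card_fin] at hcI hcJ
  rw [← Finset.card_pos] at h1 h2
  rw [← Finset.card_eq_iff_eq_univ, ← Finset.card_eq_iff_eq_univ, Fintype.card_fin]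
  omega

/-- The bipartite graph of the nonzero entries of a square matrix. -/
def blockGraph {K : ℕ} (Z : Matrix (Fin K) (Fin K) ℝ) : SimpleGraph (Fin K ⊕ Fin K) :=
  SimpleGraph.fromRel fun α β => ∃ i j, α = Sum.inl i ∧ β = Sum.inr j ∧ Z i j ≠ 0

theorem blockGraph_adj_iff {K : ℕ} {Z : Matrix (Fin K) (Fin K) ℝ} {α β : Fin K ⊕ Fin K} :
    (blockGraph Z).Adj α β ↔ (∃ i j, α = Sum.inl i ∧ β = Sum.inr j ∧ Z i j ≠ 0) ∨
      ∃ i j, β = Sum.inl i ∧ α = Sum.inr j ∧ Z i j ≠ 0 := by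
  rw [blockGraph, SimpleGraph.fromRel_adj, and_iff_right_iff_imp]
  rintro (⟨i, j, rfl, rfl, _⟩ | ⟨i, j, rfl, rfl, _⟩) <;> simp

/-- The rows and columns reachable from a given vertex are closed under the nonzero entries of `Z`,
so `FullyIndecomposable.eq_univ` makes them everything. -/
theorem FullyIndecomposable.preconnected_blockGraph {K : ℕ} {Z : Matrix (Fin K) (Fin K) ℝ}
    (hZ : FullyIndecomposable Z) : (blockGraph Z).Preconnected := by
  classical
  intro α β
  have hadj : ∀ i j, Z i j ≠ 0 → (blockGraph Z).Adj (Sum.inl i) (Sum.inr j) := fun i j h =>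
    blockGraph_adj_iff.2 (Or.inl ⟨i, j, rfl, rfl, h⟩)
  have := hZ.eq_univ
    (I := Finset.univ.filter fun i => (blockGraph Z).Reachable α (Sum.inl i))
    (J := Finset.univ.filter fun j => (blockGraph Z).Reachable α (Sum.inr j))
    (fun i j hij => by
      simp only [Finset.mem_filter, Finset.mem_univ, true_and]
      exact ⟨fun h => h.trans (hadj i j hij).reachable,
        fun h => h.trans (hadj i j hij).symm.reachable⟩)
    (by
      rcases α with i | j
      · exact Or.inl ⟨i, by simp⟩
      · exact Or.inr ⟨j, by simp⟩)
  rcases β with i | j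
  · simpa using this.1.symm.subset (Finset.mem_univ i)
  · simpa using this.2.symm.subset (Finset.mem_univ j)

theorem FullyIndecomposable.exists_blockGraph_adj {K : ℕ} {Z : Matrix (Fin K) (Fin K) ℝ}
    (hZ : FullyIndecomposable Z) (α : Fin K ⊕ Fin K) : ∃ β, (blockGraph Z).Adj α β := by
  rcases α with i | j
  · obtain ⟨i', hi, j, _, hij⟩ := hZ.2 {i} Finset.univ (by simp) ⟨i, Finset.mem_univ _⟩ (by simp)
    rw [Finset.mem_singleton.1 hi] at hij
    exact ⟨Sum.inr j, blockGraph_adj_iff.2 (Or.inl ⟨i, j, rfl, rfl, hij⟩)⟩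
  · obtain ⟨i, _, j', hj, hij⟩ := hZ.2 Finset.univ {j} ⟨j, Finset.mem_univ _⟩ (by simp) (by simp)
    rw [Finset.mem_singleton.1 hj] at hij
    exact ⟨Sum.inl i, blockGraph_adj_iff.2 (Or.inr ⟨i, j, rfl, rfl, hij⟩)⟩

/-! ### Poincaré inequality on the block graph. -/

theorem sq_sub_mean_le {ι : Type*} {s : Finset ι} {n : ℝ} (hn : 0 < n) (hs : (s.card : ℝ) = n)
    (w : ι → ℝ) (a : ℝ) :
    n * (a - n⁻¹ * ∑ y ∈ s, w y) ^ 2 ≤ ∑ y ∈ s, (a - w y) ^ 2 := by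
  have h := sq_sum_le_card_mul_sum_sq (s := s) (f := fun y => a - w y)
  rw [Finset.sum_sub_distrib, Finset.sum_const, nsmul_eq_mul, hs] at h
  have e : n * (a - n⁻¹ * ∑ y ∈ s, w y) ^ 2 = n⁻¹ * (n * a - ∑ y ∈ s, w y) ^ 2 := by
    field_simp
  rw [e, inv_mul_le_iff₀ hn]
  exact h

theorem SimpleGraph.Walk.abs_sub_le {V : Type*} {G : SimpleGraph V} {f : V → ℝ} {r : ℝ}
    (h : ∀ α β, G.Adj α β → |f α - f β| ≤ r) {α β : V} (q : G.Walk α β) :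
    |f α - f β| ≤ q.length * r := by
  induction q with
  | nil => simp
  | @cons α β γ hadj q ih =>
    rw [SimpleGraph.Walk.length_cons]
    push_cast
    linarith [_root_.abs_sub_le (f α) (f β) (f γ), h α β hadj]

/-- A Poincaré inequality for functions on blocks of equal size that are linked along the edges of
a connected graph. -/
theorem exists_sum_sq_sub_le {ι V : Type*} [Fintype ι] [Fintype V] [DecidableEq V]
    {G : SimpleGraph V} (hG : G.Preconnected) (hadj : ∀ α, ∃ β, G.Adj α β) {b : ι → V} {n : ℝ}
    (hn : 0 < n) (hcard : ∀ α, ((Finset.univ.filter (b · = α)).card : ℝ) = n) {w : ι → ℝ} {t : ℝ}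
    (ht : ∀ α β, G.Adj α β → ∑ x with b x = α, ∑ y with b y = β, (w x - w y) ^ 2 ≤ n ^ 2 * t) :
    ∃ W : ℝ, ∀ α, ∑ x with b x = α, (w x - W) ^ 2 ≤ n * ((2 + 2 * Fintype.card V ^ 2) * t) := by
  classical
  set μ : V → ℝ := fun α => n⁻¹ * ∑ x with b x = α, w x with hμ
  have h1 : ∀ α β, G.Adj α β → ∑ x with b x = α, (w x - μ β) ^ 2 ≤ n * t := fun α β h => by
    have : n * ∑ x with b x = α, (w x - μ β) ^ 2 ≤ n * (n * t) := by
      rw [Finset.mul_sum]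
      calc _ ≤ ∑ x with b x = α, ∑ y with b y = β, (w x - w y) ^ 2 :=
            Finset.sum_le_sum fun x _ => sq_sub_mean_le hn (hcard β) w (w x)
        _ ≤ n ^ 2 * t := ht α β h
        _ = _ := by ring
    exact le_of_mul_le_mul_left this hn
  have h2 : ∀ α β, G.Adj α β → (μ α - μ β) ^ 2 ≤ t := fun α β h => by
    have h3 := sq_sub_mean_le hn (hcard α) w (μ β)
    have h4 : ∑ x with b x = α, (μ β - w x) ^ 2 ≤ n * t := by
      refine le_trans (le_of_eq (Finset.sum_congr rfl fun x _ => ?_)) (h1 α β h)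
      ring
    have h5 := le_of_mul_le_mul_left (h3.trans h4) hn
    calc (μ α - μ β) ^ 2 = (μ β - μ α) ^ 2 := by ring
      _ ≤ t := h5
  rcases isEmpty_or_nonempty V with hV | ⟨⟨α₀⟩⟩
  · exact ⟨0, fun α => (hV.false α).elim⟩
  have ht0 : 0 ≤ t := by
    obtain ⟨β, hβ⟩ := hadj α₀
    exact (sq_nonneg _).trans (h2 α₀ β hβ)
  -- Neighbouring block means differ by at most `√t`, and a path has fewer than `Fintype.card V`
  -- edges.
  have h3 : ∀ α β, (μ α - μ β) ^ 2 ≤ Fintype.card V ^ 2 * t := fun α β => by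
    obtain ⟨q, hq⟩ := (hG α β).exists_isPath
    have h4 := SimpleGraph.Walk.abs_sub_le (f := μ) (r := √t)
      (fun α β h => Real.abs_le_sqrt (h2 α β h)) q
    have h5 : |μ α - μ β| ≤ Fintype.card V * √t :=
      h4.trans (mul_le_mul_of_nonneg_right (by exact_mod_cast hq.length_lt.le) (Real.sqrt_nonneg t))
    calc (μ α - μ β) ^ 2 = |μ α - μ β| ^ 2 := (sq_abs _).symm
      _ ≤ (Fintype.card V * √t) ^ 2 := pow_le_pow_left₀ (abs_nonneg _) h5 2
      _ = _ := by rw [mul_pow, Real.sq_sqrt ht0]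
  -- The means are compared through a neighbour `β` because the hypothesis contains no differences
  -- within a single block.
  refine ⟨μ α₀, fun α => ?_⟩
  obtain ⟨β, hβ⟩ := hadj α
  calc ∑ x with b x = α, (w x - μ α₀) ^ 2
      ≤ ∑ x with b x = α, (2 * (w x - μ β) ^ 2 + 2 * (μ β - μ α₀) ^ 2) := by
        refine Finset.sum_le_sum fun x _ => ?_
        nlinarith [sq_nonneg ((w x - μ β) - (μ β - μ α₀))]
    _ = 2 * ∑ x with b x = α, (w x - μ β) ^ 2 + n * (2 * (μ β - μ α₀) ^ 2) := by
        rw [Finset.sum_add_distrib, Finset.mul_sum, Finset.sum_const, nsmul_eq_mul, hcard]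
    _ ≤ 2 * (n * t) + n * (2 * (Fintype.card V ^ 2 * t)) := by
        have := h3 β α₀
        have := h1 α β hβ
        gcongr
    _ = _ := by ring

/-! ### Linear stability on the imaginary axis. -/

/-- The energy identity for the linearized equation on the imaginary axis. -/
theorem energy_le {ι : Type*} [Fintype ι] {A : ι → ι → ℝ} (hsymm : ∀ x y, A x y = A y x)
    {ε v h w : ι → ℝ} {η : ℝ} (hη : 0 ≤ η)
    (hε : ∀ x y, A x y ≠ 0 → ε x * ε y = -1) (hε1 : ∀ x, ε x ^ 2 = 1)
    (hv : ∀ x, 0 < v x) (hqve : ∀ x, v x * (η + ∑ y, A x y * v y) = 1)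
    (hw : ∀ x, h x = ε x * v x * w x) :
    ∑ x, ∑ y, A x y * (v x * v y) * (w x - w y) ^ 2 ≤
      2 * ∑ x, (h x / v x ^ 2 + ∑ y, A x y * h y) * h x := by
  -- The sign comes from `ε x * ε y = -1` on the support of `A`; it turns the cross term into that
  -- of `(w x - w y) ^ 2`.
  have hA : ∀ x y, A x y * h y * h x = -(A x y * (v x * v y) * (w x * w y)) := fun x y => by
    rw [hw, hw]
    by_cases h0 : A x y = 0
    · simp [h0]
    · linear_combination (A x y * v x * v y * w x * w y) * hε x y h0
  have hrow : ∀ x, ∑ y, A x y * (v x * v y) = 1 - η * v x := fun x => by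
    rw [← hqve x, mul_add, Finset.mul_sum]
    have : ∑ y, A x y * (v x * v y) = ∑ y, v x * (A x y * v y) :=
      Finset.sum_congr rfl fun y _ => by ring
    rw [this]
    ring
  have e1 : ∑ x, ∑ y, A x y * (v x * v y) * (w x - w y) ^ 2 =
      ∑ x, (1 - η * v x) * w x ^ 2 + ∑ x, (1 - η * v x) * w x ^ 2 +
        2 * ∑ x, ∑ y, A x y * h y * h x := by
    have h1 : ∑ x, (1 - η * v x) * w x ^ 2 = ∑ x, ∑ y, A x y * (v x * v y) * w x ^ 2 :=
      Finset.sum_congr rfl fun x _ => by rw [← hrow, Finset.sum_mul]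
    have h2 : ∑ x, (1 - η * v x) * w x ^ 2 = ∑ x, ∑ y, A x y * (v x * v y) * w y ^ 2 := by
      rw [Finset.sum_comm]
      refine Finset.sum_congr rfl fun x _ => ?_
      rw [← hrow, Finset.sum_mul]
      refine Finset.sum_congr rfl fun y _ => ?_
      rw [hsymm]
      ring
    nth_rewrite 1 [h1]
    rw [h2, Finset.mul_sum, ← Finset.sum_add_distrib, ← Finset.sum_add_distrib]
    refine Finset.sum_congr rfl fun x _ => ?_
    rw [Finset.mul_sum, ← Finset.sum_add_distrib, ← Finset.sum_add_distrib]
    refine Finset.sum_congr rfl fun y _ => ?_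
    rw [hA]
    ring
  have e2 : ∑ x, (h x / v x ^ 2 + ∑ y, A x y * h y) * h x =
      ∑ x, w x ^ 2 + ∑ x, ∑ y, A x y * h y * h x := by
    rw [← Finset.sum_add_distrib]
    refine Finset.sum_congr rfl fun x _ => ?_
    rw [add_mul, Finset.sum_mul]
    congr 1
    have := (hv x).ne'
    rw [hw]
    field_simp
    linear_combination w x ^ 2 * hε1 x
  rw [e1, e2]
  have h3 : ∑ x, (1 - η * v x) * w x ^ 2 ≤ ∑ x, w x ^ 2 := by
    refine Finset.sum_le_sum fun x _ => ?_
    nlinarith [mul_nonneg (mul_nonneg hη (hv x).le) (sq_nonneg (w x))]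
  linarith

set_option maxHeartbeats 1000000 in
/-- Stability of the linearized equation on the imaginary axis, after the addition of a rank one
term in the unstable direction `ε`. -/
theorem exists_linear_stability {s φ c C : ℝ} (hs : 0 < s) (hφ : 0 < φ) (hc : 0 < c) (hC : 0 < C)
    {K : ℕ} (hK : 0 < K) :
    ∃ B : ℝ, 0 < B ∧ ∀ (ι V : Type) [Fintype ι] [Fintype V] [DecidableEq V] (p : ℝ)
      (G : SimpleGraph V) (b : ι → V) (A : ι → ι → ℝ) (ε v h : ι → ℝ) (η F : ℝ), 0 < p →
      (Fintype.card ι : ℝ) = 2 * p → Fintype.card V = 2 * K →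
      G.Preconnected → (∀ α, ∃ β, G.Adj α β) →
      (∀ α, ((Finset.univ.filter (b · = α)).card : ℝ) = p / K) →
      (∀ x y, 0 ≤ A x y) → (∀ x y, A x y = A y x) → (∀ x y, A x y ≤ s / (p + p)) →
      (∀ x y, G.Adj (b x) (b y) → φ / (p + p) ≤ A x y) →
      (∀ x y, A x y ≠ 0 → ε x * ε y = -1) → (∀ x, ε x ^ 2 = 1) → 0 ≤ η →
      (∀ x, c ≤ v x ∧ v x ≤ C) → (∀ x, v x * (η + ∑ y, A x y * v y) = 1) →
      (∀ x, |h x / v x ^ 2 + ∑ y, A x y * h y + ε x * (p⁻¹ * ∑ y, ε y * h y)| ≤ F) →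
      ∀ x, |h x| ≤ B * F := by
  set P : ℝ := 2 + 2 * ((2 * K : ℕ) : ℝ) ^ 2 with hP
  have hP0 : 0 < P := by positivity
  set T : ℝ := 4 * K ^ 2 / (φ * c ^ 2) with hT
  have hK' : (0 : ℝ) < K := by exact_mod_cast hK
  have hT0 : 0 < T := by positivity
  set B₀ : ℝ := 8 * C ^ 2 * (P * T + (2 + 8 * C ^ 2 * P * T) / (4 * c ^ 2)) with hB₀
  have hB₀0 : 0 < B₀ := by positivity
  refine ⟨C ^ 2 * (1 + (s / 2 + 1) * B₀), by positivity, ?_⟩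
  intro ι V _ _ _ p G b A ε v h η F hp hι hV hG hadj hcard hA hsymm hflat hlow hε hε1 hη hvb hqve
    hF
  have hv : ∀ x, 0 < v x := fun x => hc.trans_le (hvb x).1
  have hεabs : ∀ x, |ε x| = 1 := fun x => by
    have := hε1 x
    rw [← sq_abs] at this
    exact (pow_eq_one_iff_of_nonneg (abs_nonneg _) two_ne_zero).1 this
  set w : ι → ℝ := fun x => ε x * h x / v x with hw
  have hhw : ∀ x, h x = ε x * v x * w x := fun x => by
    have := (hv x).ne'
    simp only [hw]
    field_simp
    linear_combination -(h x) * hε1 x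
  have hεh : ∀ x, ε x * h x = v x * w x := fun x => by
    have := (hv x).ne'
    simp only [hw]
    field_simp
  set σ : ℝ := p⁻¹ * ∑ y, ε y * h y with hσ
  set q : ℝ := p⁻¹ * ∑ y, |h y| with hq
  have hq0 : 0 ≤ q := mul_nonneg (inv_nonneg.2 hp.le) (Finset.sum_nonneg fun _ _ => abs_nonneg _)
  have hpq : ∑ y, |h y| = p * q := by rw [hq]; field_simp
  have hpσ : ∑ y, ε y * h y = p * σ := by rw [hσ]; field_simp
  have hσq : |σ| ≤ q := by
    rw [hσ, abs_mul, abs_of_pos (inv_pos.2 hp)]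
    refine mul_le_mul_of_nonneg_left ((Finset.abs_sum_le_sum_abs _ _).trans ?_) (inv_pos.2 hp).le
    exact le_of_eq (Finset.sum_congr rfl fun y _ => by rw [abs_mul, hεabs, one_mul])
  have hne : Nonempty ι := by
    rw [← Fintype.card_pos_iff]
    have : (0 : ℝ) < Fintype.card ι := by rw [hι]; positivity
    exact_mod_cast this
  have hF0 : 0 ≤ F := (abs_nonneg _).trans (hF hne.some)
  set D := ∑ x, ∑ y, A x y * (v x * v y) * (w x - w y) ^ 2 with hD
  have hDterm : ∀ x y, 0 ≤ A x y * (v x * v y) * (w x - w y) ^ 2 := fun x y =>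
    mul_nonneg (mul_nonneg (hA x y) (mul_pos (hv x) (hv y)).le) (sq_nonneg _)
  have hD0 : 0 ≤ D := Finset.sum_nonneg fun x _ => Finset.sum_nonneg fun y _ => hDterm x y
  have henergy := energy_le hsymm hη hε hε1 hv hqve hhw
  -- The equation is tested against `h`; the rank one term contributes the square `p * σ ^ 2`. By
  -- `henergy` the other summand is nonnegative too, so one estimate controls both the energy and
  -- `σ`.
  have hFh : ∑ x, (h x / v x ^ 2 + ∑ y, A x y * h y) * h x + p * σ ^ 2 ≤ F * (p * q) := by
    have e : ∑ x, (h x / v x ^ 2 + ∑ y, A x y * h y) * h x + p * σ ^ 2 =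
        ∑ x, (h x / v x ^ 2 + ∑ y, A x y * h y + ε x * σ) * h x := by
      have : p * σ ^ 2 = ∑ x, ε x * σ * h x := by
        rw [pow_two, ← mul_assoc, ← hpσ, Finset.sum_mul]
        exact Finset.sum_congr rfl fun x _ => by ring
      rw [this, ← Finset.sum_add_distrib]
      exact Finset.sum_congr rfl fun x _ => by ring
    rw [e, ← hpq, Finset.mul_sum]
    refine Finset.sum_le_sum fun x _ => (le_abs_self _).trans ?_
    rw [abs_mul]
    exact mul_le_mul_of_nonneg_right (hF x) (abs_nonneg _)
  have hDq : D ≤ 2 * (F * (p * q)) := by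
    have : 0 ≤ p * σ ^ 2 := by positivity
    linarith
  have hσsq : σ ^ 2 ≤ F * q := by
    have : p * σ ^ 2 ≤ p * (F * q) := by linarith
    exact le_of_mul_le_mul_left this hp
  have hedge : ∀ α β, G.Adj α β → ∑ x with b x = α, ∑ y with b y = β, (w x - w y) ^ 2 ≤
      (p / K) ^ 2 * (T * (F * q)) := fun α β hαβ => by
    have h1 : φ / (p + p) * c ^ 2 * ∑ x with b x = α, ∑ y with b y = β, (w x - w y) ^ 2 ≤ D := by
      rw [Finset.mul_sum]
      calc _ ≤ ∑ x with b x = α, ∑ y, A x y * (v x * v y) * (w x - w y) ^ 2 := by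
            refine Finset.sum_le_sum fun x hx => ?_
            rw [Finset.mul_sum]
            calc _ ≤ ∑ y with b y = β, A x y * (v x * v y) * (w x - w y) ^ 2 := by
                  refine Finset.sum_le_sum fun y hy => ?_
                  rw [Finset.mem_filter] at hx hy
                  refine mul_le_mul_of_nonneg_right ?_ (sq_nonneg _)
                  have h2 : c ^ 2 ≤ v x * v y := by
                    rw [pow_two]
                    exact mul_le_mul (hvb x).1 (hvb y).1 hc.le (hv x).le
                  exact mul_le_mul (hlow x y (by rwa [hx.2, hy.2])) h2 (by positivity) (hA x y)
              _ ≤ _ := Finset.sum_le_sum_of_subset_of_nonneg (Finset.filter_subset _ _)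
                  fun y _ _ => hDterm x y
        _ ≤ D := Finset.sum_le_sum_of_subset_of_nonneg (Finset.filter_subset _ _)
            fun x _ _ => Finset.sum_nonneg fun y _ => hDterm x y
    have hφp : 0 < φ / (p + p) * c ^ 2 := by positivity
    have e : (p / K) ^ 2 * (T * (F * q)) = (2 * (F * (p * q))) / (φ / (p + p) * c ^ 2) := by
      rw [hT]; field_simp; ring
    rw [e, le_div_iff₀ hφp, mul_comm]
    exact h1.trans hDq
  obtain ⟨W, hW⟩ := exists_sum_sq_sub_le hG hadj (by positivity) hcard hedge
  rw [hV] at hW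
  set Q := F * q with hQ
  have hQ0 : 0 ≤ Q := mul_nonneg hF0 hq0
  have hdev : ∑ x, (w x - W) ^ 2 ≤ 2 * p * (P * (T * Q)) := by
    rw [← Finset.sum_fiberwise Finset.univ b]
    calc _ ≤ ∑ α : V, p / K * (P * (T * Q)) := Finset.sum_le_sum fun α _ => hW α
      _ = _ := by
        rw [Finset.sum_const, Finset.card_univ, hV, nsmul_eq_mul]
        push_cast
        field_simp
  -- The Poincaré inequality says nothing about the constant `W`. It is recovered from `p * σ = ∑ v
  -- x * w x`, which equals `W * ∑ v x` plus the remainder `r`, controlled by `hdev`.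
  have hWsq : W ^ 2 ≤ (2 + 8 * C ^ 2 * P * T) / (4 * c ^ 2) * Q := by
    set r := ∑ x, v x * (w x - W) with hr
    have h1 : (∑ x, v x) * W = p * σ - r := by
      rw [← hpσ, hr, Finset.sum_mul, ← Finset.sum_sub_distrib]
      exact Finset.sum_congr rfl fun x _ => by rw [hεh]; ring
    have h2 : 2 * p * c ≤ ∑ x, v x := by
      calc 2 * p * c = ∑ x : ι, c := by
            rw [Finset.sum_const, Finset.card_univ, nsmul_eq_mul, hι]
        _ ≤ _ := Finset.sum_le_sum fun x _ => (hvb x).1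
    have h3 : r ^ 2 ≤ (2 * p * C ^ 2) * (2 * p * (P * (T * Q))) := by
      refine (Finset.sum_mul_sq_le_sq_mul_sq _ _ _).trans
        (mul_le_mul ?_ hdev (Finset.sum_nonneg fun _ _ => sq_nonneg _) (by positivity))
      calc ∑ x, v x ^ 2 ≤ ∑ x : ι, C ^ 2 :=
            Finset.sum_le_sum fun x _ => pow_le_pow_left₀ (hv x).le (hvb x).2 2
        _ = _ := by rw [Finset.sum_const, Finset.card_univ, nsmul_eq_mul, hι]
    have h4 : (2 * p * c) ^ 2 * W ^ 2 ≤ 2 * (p ^ 2 * Q) + 2 * r ^ 2 := by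
      calc (2 * p * c) ^ 2 * W ^ 2 ≤ (∑ x, v x) ^ 2 * W ^ 2 := by gcongr
        _ = (p * σ - r) ^ 2 := by rw [← h1]; ring
        _ ≤ 2 * (p ^ 2 * σ ^ 2) + 2 * r ^ 2 := by nlinarith [sq_nonneg (p * σ + r)]
        _ ≤ _ := by gcongr
    rw [div_mul_eq_mul_div, le_div_iff₀ (by positivity)]
    have h5 : p ^ 2 * (W ^ 2 * (4 * c ^ 2)) ≤ p ^ 2 * ((2 + 8 * C ^ 2 * P * T) * Q) := by
      linarith
    exact le_of_mul_le_mul_left h5 (by positivity)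
  -- The `ℓ²` bounds are of order `F * q`, where `q` is itself an average of `|h|`, so one factor
  -- `q` cancels.
  have hqsq : q * q ≤ B₀ * F * q := by
    have h1 : (p * q) ^ 2 ≤ 2 * p * ∑ x, |h x| ^ 2 := by
      rw [← hpq]
      have := sq_sum_le_card_mul_sum_sq (s := Finset.univ) (f := fun x => |h x|)
      rwa [Finset.card_univ, hι] at this
    have h2 : ∑ x, |h x| ^ 2 ≤ C ^ 2 * (2 * (2 * p * (P * (T * Q))) + 2 * p * (2 * W ^ 2)) := by
      calc ∑ x, |h x| ^ 2 ≤ ∑ x, C ^ 2 * (2 * (w x - W) ^ 2 + 2 * W ^ 2) := by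
            refine Finset.sum_le_sum fun x _ => ?_
            have e : |h x| ^ 2 = v x ^ 2 * w x ^ 2 := by
              rw [sq_abs, hhw x]
              linear_combination (v x ^ 2 * w x ^ 2) * hε1 x
            rw [e]
            refine mul_le_mul (pow_le_pow_left₀ (hv x).le (hvb x).2 2) ?_ (sq_nonneg _)
              (by positivity)
            nlinarith [sq_nonneg (w x - 2 * W)]
        _ = C ^ 2 * (2 * ∑ x, (w x - W) ^ 2 + 2 * p * (2 * W ^ 2)) := by
            rw [← Finset.mul_sum, Finset.sum_add_distrib, ← Finset.mul_sum, Finset.sum_const,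
              Finset.card_univ, nsmul_eq_mul, hι]
        _ ≤ _ := by gcongr
    have h3 : p ^ 2 * (q * q) ≤ p ^ 2 * (8 * C ^ 2 * (P * (T * Q) + W ^ 2)) := by
      calc p ^ 2 * (q * q) = (p * q) ^ 2 := by ring
        _ ≤ 2 * p * (C ^ 2 * (2 * (2 * p * (P * (T * Q))) + 2 * p * (2 * W ^ 2))) := by
            refine h1.trans ?_
            gcongr
        _ ≤ _ := by
            have : 0 ≤ p ^ 2 * (C ^ 2 * (P * (T * Q))) := by positivity
            linarith
    calc q * q ≤ 8 * C ^ 2 * (P * (T * Q) + W ^ 2) := le_of_mul_le_mul_left h3 (by positivity)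
      _ ≤ 8 * C ^ 2 * (P * (T * Q) + (2 + 8 * C ^ 2 * P * T) / (4 * c ^ 2) * Q) := by gcongr
      _ = _ := by rw [hB₀, hQ]; ring
  have hqF : q ≤ B₀ * F := by
    rcases hq0.eq_or_lt with h0 | h0
    · rw [← h0]; positivity
    · exact le_of_mul_le_mul_right hqsq h0
  intro x
  -- Flatness bounds the nonlocal term by the average `q`; the diagonal term of the equation then
  -- gives the pointwise bound.
  have h1 : |∑ y, A x y * h y| ≤ s / 2 * q := by
    calc |∑ y, A x y * h y| ≤ ∑ y, |A x y * h y| := Finset.abs_sum_le_sum_abs _ _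
      _ ≤ ∑ y, s / (p + p) * |h y| := by
          refine Finset.sum_le_sum fun y _ => ?_
          rw [abs_mul, abs_of_nonneg (hA x y)]
          exact mul_le_mul_of_nonneg_right (hflat x y) (abs_nonneg _)
      _ = s / 2 * q := by rw [← Finset.mul_sum, hpq]; field_simp; ring
  have h2 : |h x / v x ^ 2| ≤ F + s / 2 * q + q := by
    have e : h x / v x ^ 2 = (h x / v x ^ 2 + ∑ y, A x y * h y + ε x * σ) - ∑ y, A x y * h y
        - ε x * σ := by ring
    rw [e]
    refine (abs_sub _ _).trans (add_le_add ((abs_sub _ _).trans (add_le_add (hF x) h1)) ?_)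
    rwa [abs_mul, hεabs, one_mul]
  rw [abs_div, abs_of_pos (pow_pos (hv x) 2), div_le_iff₀ (pow_pos (hv x) 2)] at h2
  calc |h x| ≤ (F + s / 2 * q + q) * v x ^ 2 := h2
    _ ≤ (F + s / 2 * (B₀ * F) + B₀ * F) * C ^ 2 := by
        have := (hvb x).2
        have := (hv x).le
        gcongr
    _ = _ := by ring

/-! ### General properties of the quadratic vector equation. -/

section General

variable {ι : Type*} [Fintype ι] {A : Matrix ι ι ℝ} {z : ℂ}

theorem PerturbedQVE.mul_eq {g d : ι → ℂ} (h : PerturbedQVE A z g d) (hg : ∀ x, g x ≠ 0) (x : ι) :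
    g x * (z + ∑ y, (A x y : ℂ) * g y + d x) = -1 := by
  rw [← h x]
  have := hg x
  field_simp

theorem IsQVESolution.ne_zero {u : ι → ℂ} (h : IsQVESolution A z u) (x : ι) : u x ≠ 0 := fun h0 => by
  have := h.1 x
  rw [h0, Complex.zero_im] at this
  exact lt_irrefl _ this

theorem IsQVESolution.mul_eq {u : ι → ℂ} (h : IsQVESolution A z u) (x : ι) :
    u x * (z + ∑ y, (A x y : ℂ) * u y) = -1 := by
  simpa using h.2.mul_eq h.ne_zero x

/-- These conditions are closed and so survive limits; strict positivity is recovered from the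
equation since `-1 / u x` has imaginary part at least `z.im`. -/
theorem isQVESolution_of_mul_eq (hA : ∀ x y, 0 ≤ A x y) (hz : 0 < z.im) {u : ι → ℂ}
    (h0 : ∀ x, 0 ≤ (u x).im) (h : ∀ x, u x * (z + ∑ y, (A x y : ℂ) * u y) = -1) :
    IsQVESolution A z u := by
  have hne : ∀ x, u x ≠ 0 := fun x hx => by simpa [hx] using h x
  have hstep : ∀ x, -1 / u x = z + ∑ y, (A x y : ℂ) * u y := fun x => by
    rw [← h x, mul_div_cancel_left₀ _ (hne x)]
  refine ⟨fun x => ?_, fun x => by simpa using hstep x⟩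
  have h1 : 0 < (-1 / u x).im := by
    rw [hstep, im_affine]
    have : 0 ≤ ∑ y, A x y * (u y).im := Finset.sum_nonneg fun y _ => mul_nonneg (hA x y) (h0 y)
    linarith
  rw [im_neg_one_div] at h1
  have := norm_pos_iff.2 (hne x)
  exact (div_pos_iff_of_pos_right (by positivity)).1 h1

theorem IsQVESolution.qveSolution_eq (hA : ∀ x y, 0 ≤ A x y) (hz : 0 < z.im) {u : ι → ℂ}
    (h : IsQVESolution A z u) : qveSolution A z = u :=
  (existsUnique_isQVESolution hA hz).unique (isQVESolution_qveSolution hA hz) h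

theorem norm_qveSolution_le (hA : ∀ x y, 0 ≤ A x y) (hz : 0 < z.im) :
    ‖qveSolution A z‖ ≤ 1 / z.im := by
  have h := isQVESolution_qveSolution hA hz
  refine (pi_norm_le_iff_of_nonneg (by positivity)).2 fun x => ?_
  rw [h.eq_step x]
  exact norm_step_le hA hz h.1 x

/-- The solutions near `z` stay in a compact ball, and each cluster point solves the equation at
`z`, hence is the unique solution. -/
theorem continuousAt_qveSolution (hA : ∀ x y, 0 ≤ A x y) (hz : 0 < z.im) :
    ContinuousAt (qveSolution A) z := by
  have him : ∀ᶠ w : ℂ in 𝓝 z, z.im / 2 < w.im :=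
    (Complex.continuous_im.tendsto z).eventually (lt_mem_nhds (by linarith))
  refine (isCompact_closedBall (0 : ι → ℂ) (1 / (z.im / 2))).tendsto_nhds_of_unique_mapClusterPt
    ?_ ?_
  · filter_upwards [him] with w hw
    rw [mem_closedBall_zero_iff]
    exact (norm_qveSolution_le hA (by linarith)).trans
      (one_div_le_one_div_of_le (by linarith) hw.le)
  · intro u _ hu
    obtain ⟨U, hU, hlim⟩ := mapClusterPt_iff_ultrafilter.1 hu
    have hsol : ∀ᶠ w in (U : Filter ℂ), IsQVESolution A w (qveSolution A w) := by
      filter_upwards [hU him] with w hw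
      exact isQVESolution_qveSolution hA (by linarith [show z.im / 2 < w.im from hw])
    have hlx : ∀ x, Tendsto (fun w => qveSolution A w x) U (𝓝 (u x)) := tendsto_pi_nhds.1 hlim
    have hid : Tendsto (fun w : ℂ => w) U (𝓝 z) := hU
    refine (IsQVESolution.qveSolution_eq hA hz (isQVESolution_of_mul_eq hA hz ?_ ?_)).symm
    · intro x
      refine ge_of_tendsto ((Complex.continuous_im.tendsto _).comp (hlx x)) ?_
      filter_upwards [hsol] with w hw using (hw.1 x).le
    · intro x
      have h1 : Tendsto (fun w => qveSolution A w x * (w + ∑ y, (A x y : ℂ) * qveSolution A w y)) U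
          (𝓝 (u x * (z + ∑ y, (A x y : ℂ) * u y))) :=
        (hlx x).mul (hid.add (tendsto_finsetSum _ fun y _ => (hlx y).const_mul _))
      refine tendsto_nhds_unique h1 (tendsto_const_nhds.congr' ?_)
      filter_upwards [hsol] with w hw using (hw.mul_eq x).symm

/-- The map `u ↦ -conj u` sends solutions at `z` to solutions at `-conj z`, which is `z` on the
imaginary axis; uniqueness makes the real part vanish. -/
theorem exists_qveSolution_imaginaryAxis (hA : ∀ x y, 0 ≤ A x y) {η : ℝ} (hη : 0 < η) :
    ∃ v : ι → ℝ, (∀ x, 0 < v x) ∧ (qveSolution A (Complex.I * η) = fun x => Complex.I * v x) ∧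
      ∀ x, v x * (η + ∑ y, A x y * v y) = 1 := by
  have hz : 0 < (Complex.I * η).im := by simpa using hη
  have h := isQVESolution_qveSolution hA hz
  set u := qveSolution A (Complex.I * η) with hu
  have hconj : IsQVESolution A (Complex.I * η) (fun x => -(starRingEnd ℂ) (u x)) := by
    refine isQVESolution_of_mul_eq hA hz (fun x => by simpa using (h.1 x).le) fun x => ?_
    have := congrArg (starRingEnd ℂ) (h.mul_eq x)
    simp only [map_mul, map_add, map_sum, Complex.conj_I, Complex.conj_ofReal, map_neg,
      map_one] at this
    simp only [mul_neg, Finset.sum_neg_distrib]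
    linear_combination this
  have hre : ∀ x, (u x).re = 0 := fun x => by
    have h1 := congrArg Complex.re (congrFun (hconj.qveSolution_eq hA hz) x)
    rw [← hu] at h1
    simp only [Complex.neg_re, Complex.conj_re] at h1
    linarith
  have hui : ∀ x, u x = Complex.I * ((u x).im : ℝ) := fun x => by
    apply Complex.ext <;> simp [hre]
  refine ⟨fun x => (u x).im, h.1, funext hui, fun x => ?_⟩
  have h1 := congrArg Complex.re (h.mul_eq x)
  rw [Complex.mul_re, im_affine, hre] at h1
  simp only [Complex.mul_im, Complex.I_re, Complex.I_im, Complex.ofReal_re, Complex.ofReal_im,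
    Complex.neg_re, Complex.one_re] at h1
  linarith

end General

/-! ### Chiral symmetry and the stability operator. -/

section Symmetrization

variable {p : ℕ} {S : Matrix (Fin p) (Fin p) ℝ}

/-- The sign vector `(1, -1)` that spans the unstable direction. -/
def chiralSign (p : ℕ) : Fin p ⊕ Fin p → ℝ := Sum.elim 1 (-1)

theorem chiralSign_sq (x : Fin p ⊕ Fin p) : chiralSign p x ^ 2 = 1 := by
  rcases x with i | i <;> simp [chiralSign]

theorem symmetrization_symm (x y : Fin p ⊕ Fin p) :
    symmetrization S x y = symmetrization S y x := by
  rcases x with i | i <;> rcases y with k | k <;> simp [symmetrization]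

theorem chiralSign_mul {x y : Fin p ⊕ Fin p} (h : symmetrization S x y ≠ 0) :
    chiralSign p x * chiralSign p y = -1 := by
  rcases x with i | i <;> rcases y with k | k <;> simp_all [symmetrization, chiralSign]

theorem symmetrization_le {s : ℝ} (hs : 0 < s) (hflat : IsFlat s S) (x y : Fin p ⊕ Fin p) :
    symmetrization S x y ≤ s / ((p : ℝ) + p) := by
  have : 0 ≤ s / ((p : ℝ) + p) := by positivity
  have := hflat
  unfold IsFlat at this
  rcases x with i | i <;> rcases y with k | k <;> simp_all [symmetrization]

theorem avg_inl_eq_avg_inr_iff (hp : 0 < p) (g : Fin p ⊕ Fin p → ℂ) :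
    avg (fun i => g (Sum.inl i)) = avg (fun k => g (Sum.inr k)) ↔
      ∑ x, (chiralSign p x : ℂ) * g x = 0 := by
  have hp' : ((p : ℂ))⁻¹ ≠ 0 := inv_ne_zero (by exact_mod_cast hp.ne')
  rw [avg, avg, Fintype.card_fin, mul_right_inj' hp', Fintype.sum_sum_type]
  simp [chiralSign, sub_eq_zero, ← sub_eq_add_neg]

/-- Summing `u (z + 𝔖 u) = -1` against the sign vector kills the constant, and also the quadratic
term, since `𝔖` is symmetric and links opposite signs only. This leaves `z` times the difference of
the two sums. -/
theorem IsQVESolution.avg_inl_eq_avg_inr (hp : 0 < p) {z : ℂ} (hz : z ≠ 0) {u : Fin p ⊕ Fin p → ℂ}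
    (h : IsQVESolution (symmetrization S) z u) :
    avg (fun i => u (Sum.inl i)) = avg (fun k => u (Sum.inr k)) := by
  rw [avg_inl_eq_avg_inr_iff hp]
  set ε : Fin p ⊕ Fin p → ℂ := fun x => (chiralSign p x : ℂ) with hε
  have h1 : ∑ x, ε x * (u x * (z + ∑ y, (symmetrization S x y : ℂ) * u y)) = 0 := by
    simp only [h.mul_eq]
    rw [Fintype.sum_sum_type]
    simp [hε, chiralSign]
  have h2 : ∑ x, ∑ y, ε x * (u x * ((symmetrization S x y : ℂ) * u y)) = 0 := by
    have h3 : ∑ x, ∑ y, ε x * (u x * ((symmetrization S x y : ℂ) * u y)) =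
        -∑ x, ∑ y, ε x * (u x * ((symmetrization S x y : ℂ) * u y)) := by
      nth_rewrite 1 [Finset.sum_comm]
      rw [← Finset.sum_neg_distrib]
      refine Finset.sum_congr rfl fun y _ => ?_
      rw [← Finset.sum_neg_distrib]
      refine Finset.sum_congr rfl fun x _ => ?_
      rw [symmetrization_symm]
      rcases x with i | i <;> rcases y with k | k <;> simp [hε, symmetrization, chiralSign] <;> ring
    linear_combination h3 / 2
  have h4 : z * ∑ x, ε x * u x = 0 := by
    simp only [mul_add, Finset.sum_add_distrib, Finset.mul_sum] at h1 h2 ⊢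
    rw [h2, add_zero] at h1
    rw [← h1]
    exact Finset.sum_congr rfl fun x _ => by ring
  exact (mul_eq_zero.1 h4).resolve_left hz

/-- The negative linearization `-m⁻² + 𝔖` of the quadratic vector equation, plus a rank one matrix
in the unstable direction. -/
noncomputable def stabilityMatrix (S : Matrix (Fin p) (Fin p) ℝ) (m : Fin p ⊕ Fin p → ℂ) :
    Matrix (Fin p ⊕ Fin p) (Fin p ⊕ Fin p) ℂ :=
  Matrix.diagonal (fun x => -(1 / m x ^ 2)) + (symmetrization S).map (↑) +
    Matrix.of fun x y => (chiralSign p x : ℂ) * ((p : ℂ)⁻¹ * (chiralSign p y : ℂ))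

theorem stabilityMatrix_mulVec (m h : Fin p ⊕ Fin p → ℂ) (x : Fin p ⊕ Fin p) :
    (stabilityMatrix S m).mulVec h x = -(h x / m x ^ 2) + ∑ y, (symmetrization S x y : ℂ) * h y +
      (chiralSign p x : ℂ) * ((p : ℂ)⁻¹ * ∑ y, (chiralSign p y : ℂ) * h y) := by
  rw [stabilityMatrix, Matrix.add_mulVec, Matrix.add_mulVec, Pi.add_apply, Pi.add_apply,
    Matrix.mulVec_diagonal]
  congr 1
  · congr 1
    ring
  · rw [Matrix.mulVec, dotProduct, Finset.mul_sum, Finset.mul_sum]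
    exact Finset.sum_congr rfl fun y _ => by rw [Matrix.of_apply]; ring

theorem stabilityMatrix_transpose (m : Fin p ⊕ Fin p → ℂ) :
    (stabilityMatrix S m).transpose = stabilityMatrix S m := by
  ext x y
  simp only [stabilityMatrix, Matrix.transpose_apply, Matrix.add_apply, Matrix.map_apply,
    Matrix.of_apply, symmetrization_symm (S := S) y x]
  rw [← Matrix.transpose_apply (Matrix.diagonal _), Matrix.diagonal_transpose]
  ring

/-- The exact equation for the difference of two solutions of perturbed quadratic vector
equations. -/
theorem stabilityMatrix_mulVec_sub {z : ℂ} {m g d : Fin p ⊕ Fin p → ℂ} (hm0 : ∀ x, m x ≠ 0)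
    (hg0 : ∀ x, g x ≠ 0) (hm : PerturbedQVE (symmetrization S) z m 0)
    (hg : PerturbedQVE (symmetrization S) z g d)
    (hms : ∑ x, (chiralSign p x : ℂ) * m x = 0) (hgs : ∑ x, (chiralSign p x : ℂ) * g x = 0)
    (x : Fin p ⊕ Fin p) :
    (stabilityMatrix S m).mulVec (g - m) x = -(d x + (g x - m x) ^ 2 / (m x ^ 2 * g x)) := by
  have h1 : ∑ y, (chiralSign p y : ℂ) * (g - m) y = 0 := by
    simp only [Pi.sub_apply, mul_sub, Finset.sum_sub_distrib, hms, hgs, sub_zero]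
  have h2 : ∑ y, (symmetrization S x y : ℂ) * (g - m) y = -1 / g x + 1 / m x - d x := by
    have e1 := hm x
    have e2 := hg x
    simp only [Pi.sub_apply, mul_sub, Finset.sum_sub_distrib]
    simp only [Pi.zero_apply] at e1
    linear_combination e1 - e2
  rw [stabilityMatrix_mulVec, h1, h2, Pi.sub_apply]
  have := hm0 x
  have := hg0 x
  field_simp
  ring

end Symmetrization

/-! ### Stability on and near the imaginary axis, uniformly in the dimension. -/

theorem exists_imaginaryAxis_stability {s φ : ℝ} (hs : 0 < s) (hφ : 0 < φ) {K : ℕ} (hK : 0 < K) :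
    ∃ c C B : ℝ, 0 < c ∧ 0 < C ∧ 0 < B ∧ ∀ (p : ℕ) (S : Matrix (Fin p) (Fin p) ℝ), 0 < p →
      (∀ i k, 0 ≤ S i k) → IsFlat s S → BlockFullyIndecomposable φ K S →
      ∀ η : ℝ, 0 < η → η ≤ 10 → ∃ v : Fin p ⊕ Fin p → ℝ, (∀ x, c ≤ v x ∧ v x ≤ C) ∧
        (qveSolution (symmetrization S) (Complex.I * η) = fun x => Complex.I * v x) ∧
        ∀ h, ‖h‖ ≤ B * ‖(stabilityMatrix S fun x => Complex.I * v x).mulVec h‖ := by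
  obtain ⟨c, C, hc, hC, hbd⟩ := exists_imaginaryAxis_bounds hs hφ hK
  obtain ⟨B, hB, hstab⟩ := exists_linear_stability hs hφ hc hC hK
  refine ⟨c, C, 2 * B, hc, hC, by positivity, ?_⟩
  intro p S hp hS hflat hblock η hη hη'
  have hp' : (0 : ℝ) < p := by exact_mod_cast hp
  obtain ⟨v, hv, hvm, hqve⟩ := exists_qveSolution_imaginaryAxis (symmetrization_nonneg hS) hη
  obtain ⟨Z, b, hZ, hcard, hlow⟩ := hblock.exists_blockMap
  have hvb : ∀ x, c ≤ v x ∧ v x ≤ C := by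
    obtain ⟨h1, h2⟩ := hbd p S Z b η (fun i => v (Sum.inl i)) (fun k => v (Sum.inr k)) hp hS hflat
      hZ hcard hlow hη hη' (fun i => hv _) (fun k => hv _)
      (fun i => by simpa [symmetrization] using hqve (Sum.inl i))
      (fun k => by simpa [symmetrization] using hqve (Sum.inr k))
    rintro (i | k)
    exacts [h1 i, h2 k]
  refine ⟨v, hvb, hvm, fun h => ?_⟩
  -- For `m = i v` the diagonal `-1 / m²` is `1 / v²`, so the matrix is real and acts separately on
  -- real and imaginary parts; their sum costs the factor `2`.
  have hreal : ∀ (h : Fin p ⊕ Fin p → ℝ) (F : ℝ),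
      (∀ x, |h x / v x ^ 2 + ∑ y, symmetrization S x y * h y +
        chiralSign p x * ((p : ℝ)⁻¹ * ∑ y, chiralSign p y * h y)| ≤ F) → ∀ x, |h x| ≤ B * F := by
    intro h F hF
    refine hstab (Fin p ⊕ Fin p) (Fin K ⊕ Fin K) p (blockGraph Z) (Sum.map b b) (symmetrization S)
      (chiralSign p) v h η F hp' (by simp [two_mul]) (by simp [two_mul]) hZ.preconnected_blockGraph
      hZ.exists_blockGraph_adj ?_ (symmetrization_nonneg hS) symmetrization_symm
      (symmetrization_le hs hflat) ?_ (fun x y => chiralSign_mul) chiralSign_sq hη.le hvb hqve hF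
    · rintro (i | i) <;>
        rw [← hcard i, Finset.card_filter, Finset.card_filter, Fintype.sum_sum_type] <;> simp
    · rintro (i | i) (k | k) hadj <;> rw [blockGraph_adj_iff] at hadj <;>
        simp at hadj <;> simpa [symmetrization] using hlow _ _ hadj
  set f := (stabilityMatrix S fun x => Complex.I * v x).mulVec h with hf
  have hfx : ∀ x, f x = h x * ((1 / v x ^ 2 : ℝ) : ℂ) +
      ∑ y, (symmetrization S x y : ℂ) * h y +
      (chiralSign p x : ℂ) * (((p : ℝ)⁻¹ : ℝ) * ∑ y, (chiralSign p y : ℂ) * h y) := fun x => by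
    rw [hf, stabilityMatrix_mulVec, mul_pow, Complex.I_sq]
    push_cast
    ring
  have hre : ∀ x, |(h x).re| ≤ B * ‖f‖ := by
    refine hreal (fun x => (h x).re) ‖f‖ fun x => ?_
    refine le_trans (le_of_eq ?_) ((Complex.abs_re_le_norm (f x)).trans (norm_le_pi_norm f x))
    rw [hfx, Complex.add_re, Complex.add_re, Complex.re_mul_ofReal, Complex.re_sum,
      Complex.re_ofReal_mul, Complex.re_ofReal_mul, Complex.re_sum]
    simp only [Complex.re_ofReal_mul, mul_one_div]
  have him : ∀ x, |(h x).im| ≤ B * ‖f‖ := by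
    refine hreal (fun x => (h x).im) ‖f‖ fun x => ?_
    refine le_trans (le_of_eq ?_) ((Complex.abs_im_le_norm (f x)).trans (norm_le_pi_norm f x))
    rw [hfx, Complex.add_im, Complex.add_im, Complex.im_mul_ofReal, Complex.im_sum,
      Complex.im_ofReal_mul, Complex.im_ofReal_mul, Complex.im_sum]
    simp only [Complex.im_ofReal_mul, mul_one_div]
  refine (pi_norm_le_iff_of_nonneg (by positivity)).2 fun x => ?_
  have := Complex.norm_le_abs_re_add_abs_im (h x)
  linarith [hre x, him x]

theorem norm_le_two_mul_of_near {ι : Type*} {m : ι → ℂ} {v : ι → ℝ} [Fintype ι] {c C r : ℝ}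
    (hv : ∀ x, c ≤ v x ∧ v x ≤ C) (hm : ‖m - fun x => Complex.I * (v x : ℂ)‖ ≤ r) (hr : r ≤ c / 2)
    (hc : 0 < c) (x : ι) :
    c / 2 ≤ ‖m x‖ ∧ ‖m x‖ ≤ C + c ∧ c / 2 ≤ (m x).im ∧ ‖m x - Complex.I * v x‖ ≤ r := by
  have h1 : ‖m x - Complex.I * v x‖ ≤ r := (norm_le_pi_norm _ x).trans hm
  have h2 := Complex.abs_im_le_norm (m x - Complex.I * v x)
  simp only [Complex.sub_im, Complex.mul_im, Complex.I_re, Complex.I_im, Complex.ofReal_re,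
    Complex.ofReal_im, mul_zero, zero_add, one_mul] at h2
  have h3 := neg_abs_le ((m x).im - v x)
  have him : c / 2 ≤ (m x).im := by linarith [(hv x).1]
  refine ⟨him.trans ((le_abs_self _).trans (Complex.abs_im_le_norm _)), ?_, him, h1⟩
  have h4 := norm_le_norm_add_norm_sub' (m x) (Complex.I * v x)
  rw [norm_mul, Complex.norm_I, one_mul, Complex.norm_real, Real.norm_eq_abs,
    abs_of_pos (hc.trans_le (hv x).1)] at h4
  linarith [(hv x).2]

/-- The linear stability on the imaginary axis persists for nearby diagonal parts. -/
theorem stability_of_near {p : ℕ} {S : Matrix (Fin p) (Fin p) ℝ} {c C B r : ℝ} (hc : 0 < c)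
    (hB : 0 < B) {v : Fin p ⊕ Fin p → ℝ} (hv : ∀ x, c ≤ v x ∧ v x ≤ C)
    (hstab : ∀ h, ‖h‖ ≤ B * ‖(stabilityMatrix S fun x => Complex.I * v x).mulVec h‖)
    (hr0 : 0 ≤ r) (hr : r ≤ c / 2) (hr' : B * (r * (4 * (2 * C + c) / c ^ 4)) ≤ 1 / 2)
    {m : Fin p ⊕ Fin p → ℂ} (hm : ‖m - fun x => Complex.I * (v x : ℂ)‖ ≤ r)
    (h : Fin p ⊕ Fin p → ℂ) :
    ‖h‖ ≤ 2 * B * ‖(stabilityMatrix S m).mulVec h‖ := by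
  set m₀ : Fin p ⊕ Fin p → ℂ := fun x => Complex.I * v x with hm₀
  have hdiag : ∀ x, ‖1 / m x ^ 2 - 1 / m₀ x ^ 2‖ ≤ r * (4 * (2 * C + c) / c ^ 4) := fun x => by
    obtain ⟨h1, h2, -, h3⟩ := norm_le_two_mul_of_near hv hm hr hc x
    have h4 : ‖m₀ x‖ = v x := by
      simp only [hm₀]
      rw [norm_mul, Complex.norm_I, one_mul, Complex.norm_real, Real.norm_eq_abs,
        abs_of_pos (hc.trans_le (hv x).1)]
    have hmx : m x ≠ 0 := norm_pos_iff.1 (by linarith)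
    have hm₀x : m₀ x ≠ 0 := norm_pos_iff.1 (by rw [h4]; linarith [(hv x).1])
    have e : 1 / m x ^ 2 - 1 / m₀ x ^ 2 = -((m x - m₀ x) * (m x + m₀ x) / (m x ^ 2 * m₀ x ^ 2)) := by
      field_simp
      ring
    have h5 : ‖m x + m₀ x‖ ≤ 2 * C + c := by
      refine (norm_add_le _ _).trans ?_
      rw [h4]
      linarith [(hv x).2]
    have h6 : (c / 2) ^ 2 * c ^ 2 ≤ ‖m x‖ ^ 2 * ‖m₀ x‖ ^ 2 := by
      rw [h4]
      have := (hv x).1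
      gcongr
    rw [e, norm_neg, norm_div, norm_mul, norm_mul, norm_pow, norm_pow]
    calc _ ≤ r * (2 * C + c) / ((c / 2) ^ 2 * c ^ 2) := by
          have : 0 ≤ 2 * C + c := (norm_nonneg _).trans h5
          gcongr
      _ = _ := by field_simp; ring
  have hdiff : ‖(stabilityMatrix S m₀).mulVec h‖ ≤ ‖(stabilityMatrix S m).mulVec h‖ +
      r * (4 * (2 * C + c) / c ^ 4) * ‖h‖ := by
    -- The sign of `2 * C + c` is known only through some index `x`, so an empty index set is
    -- treated apart.
    have hnn : 0 ≤ r * (4 * (2 * C + c) / c ^ 4) * ‖h‖ := by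
      rcases isEmpty_or_nonempty (Fin p ⊕ Fin p) with he | ⟨⟨x⟩⟩
      · have : h = 0 := Subsingleton.elim _ _
        simp [this]
      · exact mul_nonneg ((norm_nonneg _).trans (hdiag x)) (norm_nonneg _)
    refine (pi_norm_le_iff_of_nonneg (by positivity)).2 fun x => ?_
    have e : (stabilityMatrix S m₀).mulVec h x = (stabilityMatrix S m).mulVec h x +
        (1 / m x ^ 2 - 1 / m₀ x ^ 2) * h x := by
      rw [stabilityMatrix_mulVec, stabilityMatrix_mulVec]
      ring
    rw [e]
    refine (norm_add_le _ _).trans (add_le_add (norm_le_pi_norm _ x) ?_)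
    rw [norm_mul]
    exact mul_le_mul (hdiag x) (norm_le_pi_norm h x) (norm_nonneg _)
      ((norm_nonneg _).trans (hdiag x))
  have h1 := (hstab h).trans (mul_le_mul_of_nonneg_left hdiff hB.le)
  have h2 := mul_le_mul_of_nonneg_right hr' (norm_nonneg h)
  linarith

/-! ### Absorbing the quadratic remainder. -/

section Nonlinear

variable {p : ℕ} {S : Matrix (Fin p) (Fin p) ℝ} {a B : ℝ} {z : ℂ} {m g d : Fin p ⊕ Fin p → ℂ}

theorem norm_remainder_le (ha : 0 < a) (hm : ∀ x, a ≤ ‖m x‖) (hg : ∀ x, a ≤ ‖g x‖) :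
    ‖fun x => (g x - m x) ^ 2 / (m x ^ 2 * g x)‖ ≤ ‖g - m‖ ^ 2 / a ^ 3 := by
  refine (pi_norm_le_iff_of_nonneg (by positivity)).2 fun x => ?_
  rw [norm_div, norm_mul, norm_pow, norm_pow]
  have h1 : ‖g x - m x‖ ≤ ‖g - m‖ := norm_le_pi_norm (g - m) x
  have h2 : a ^ 3 ≤ ‖m x‖ ^ 2 * ‖g x‖ := by
    rw [pow_succ]
    have := hm x
    have := hg x
    gcongr
  gcongr

/-- The stability bound applied to the exact difference equation leaves a quadratic remainder; by
`hsmall` it is at most half of the left side and is absorbed. -/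
theorem norm_sub_le_of_stability (ha : 0 < a) (hB : 0 < B) (hma : ∀ x, a ≤ ‖m x‖)
    (hga : ∀ x, a ≤ ‖g x‖) (hm : PerturbedQVE (symmetrization S) z m 0)
    (hg : PerturbedQVE (symmetrization S) z g d)
    (hms : ∑ x, (chiralSign p x : ℂ) * m x = 0) (hgs : ∑ x, (chiralSign p x : ℂ) * g x = 0)
    (hstab : ∀ h, ‖h‖ ≤ B * ‖(stabilityMatrix S m).mulVec h‖)
    (hsmall : B * (‖g - m‖ / a ^ 3) ≤ 1 / 2) : ‖g - m‖ ≤ 2 * B * ‖d‖ := by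
  have hm0 : ∀ x, m x ≠ 0 := fun x => norm_pos_iff.1 (ha.trans_le (hma x))
  have hg0 : ∀ x, g x ≠ 0 := fun x => norm_pos_iff.1 (ha.trans_le (hga x))
  have e : (stabilityMatrix S m).mulVec (g - m) =
      -(d + fun x => (g x - m x) ^ 2 / (m x ^ 2 * g x)) :=
    funext fun x => stabilityMatrix_mulVec_sub hm0 hg0 hm hg hms hgs x
  have h1 := hstab (g - m)
  rw [e, norm_neg] at h1
  have h2 := (norm_add_le d _).trans (add_le_add_right (norm_remainder_le ha hma hga) ‖d‖)
  have h3 := h1.trans (mul_le_mul_of_nonneg_left h2 hB.le)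
  have h4 : B * (‖g - m‖ ^ 2 / a ^ 3) = B * (‖g - m‖ / a ^ 3) * ‖g - m‖ := by ring
  have h5 := mul_le_mul_of_nonneg_right hsmall (norm_nonneg (g - m))
  linarith

end Nonlinear

/-! ### Scalar products and the adjoint inverse. -/

theorem norm_scalarProd_le {ι : Type*} [Fintype ι] (v w : ι → ℂ) :
    ‖scalarProd v w‖ ≤ ‖v‖ * ‖w‖ := by
  rcases isEmpty_or_nonempty ι with h | h
  · simp [scalarProd]
    positivity
  · have hc : (0 : ℝ) < Fintype.card ι := by exact_mod_cast Fintype.card_pos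
    rw [scalarProd, norm_mul, norm_inv, Complex.norm_natCast, inv_mul_le_iff₀ hc]
    calc _ ≤ ∑ i, ‖(starRingEnd ℂ) (v i) * w i‖ := norm_sum_le _ _
      _ ≤ ∑ i : ι, ‖v‖ * ‖w‖ := Finset.sum_le_sum fun i _ => by
          rw [norm_mul, RCLike.norm_conj]
          exact mul_le_mul (norm_le_pi_norm v i) (norm_le_pi_norm w i) (norm_nonneg _)
            (norm_nonneg _)
      _ = _ := by simp

theorem infOpNorm_le {ι : Type*} [Fintype ι] [DecidableEq ι] {T : Matrix ι ι ℂ} {B : ℝ}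
    (hB : 0 ≤ B) (h : ∀ w, ‖T.mulVec w‖ ≤ B * ‖w‖) : infOpNorm T ≤ B :=
  ContinuousLinearMap.opNorm_le_bound _ hB fun w => by simpa using h w

theorem norm_mulVec_le_infOpNorm {ι : Type*} [Fintype ι] [DecidableEq ι] (T : Matrix ι ι ℂ)
    (w : ι → ℂ) : ‖T.mulVec w‖ ≤ infOpNorm T * ‖w‖ := by
  simpa [infOpNorm] using (LinearMap.toContinuousLinearMap (Matrix.toLin' T)).le_opNorm w

/-- A symmetric matrix that is bounded from below has a bounded inverse, which can be moved to the
other side of the scalar product. -/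
theorem exists_adjoint_inverse {ι : Type*} [Fintype ι] [DecidableEq ι] {M : Matrix ι ι ℂ}
    (hM : M.transpose = M) {B : ℝ} (hB : 0 ≤ B) (h : ∀ w, ‖w‖ ≤ B * ‖M.mulVec w‖) :
    ∃ T : Matrix ι ι ℂ, infOpNorm T ≤ B ∧
      ∀ w u f, M.mulVec u = -f → scalarProd w u = scalarProd (T.mulVec w) f := by
  have hinj : Function.Injective M.mulVec := fun u w huw => by
    have h1 := h (u - w)
    rw [Matrix.mulVec_sub, sub_eq_zero.2 huw, norm_zero, mul_zero] at h1
    exact sub_eq_zero.1 (norm_le_zero_iff.1 h1)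
  have hdet : IsUnit M.det :=
    (Matrix.isUnit_iff_isUnit_det _).1 (Matrix.mulVec_injective_iff_isUnit.1 hinj)
  have hinv : ∀ f, M.mulVec (M⁻¹.mulVec f) = f := fun f => by
    rw [Matrix.mulVec_mulVec, Matrix.mul_nonsing_inv _ hdet, Matrix.one_mulVec]
  -- As `M` is symmetric rather than Hermitian, the adjoint of `-M⁻¹` is minus its entrywise
  -- conjugate. This form also carries the bound on `M⁻¹` over to `T`, since conjugation preserves
  -- the maximum norm.
  have hT : ∀ w, (-(M⁻¹.map (starRingEnd ℂ))).mulVec w =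
      -star (M⁻¹.mulVec (star w)) := fun w => by
    funext x
    simp [Matrix.mulVec, dotProduct]
  refine ⟨-(M⁻¹.map (starRingEnd ℂ)), infOpNorm_le hB fun w => ?_, fun w u f huf => ?_⟩
  · rw [hT, norm_neg, norm_star]
    have h1 := h (M⁻¹.mulVec (star w))
    rwa [hinv, norm_star] at h1
  · have h1 : (M⁻¹.mulVec (star w)) ⬝ᵥ (M.mulVec u) = star w ⬝ᵥ u := by
      rw [Matrix.dotProduct_mulVec, ← Matrix.mulVec_transpose, hM, hinv]
    rw [huf, dotProduct_neg] at h1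
    rw [hT, scalarProd, scalarProd]
    congr 1
    have h2 : ∑ i, (starRingEnd ℂ) (w i) * u i = star w ⬝ᵥ u := rfl
    rw [h2, ← h1, dotProduct, ← Finset.sum_neg_distrib]
    exact Finset.sum_congr rfl fun x _ => by simp

/-! ### Continuation away from the imaginary axis and the limit at zero. -/

theorem le_half_of_gap {f : ℝ → ℝ} (hf : ContinuousOn f (Set.Icc 0 1)) (h0 : f 0 = 0) {l : ℝ}
    (hl : 0 < l) (hgap : ∀ t ∈ Set.Icc (0 : ℝ) 1, f t ≤ l → f t ≤ l / 2) : f 1 ≤ l := by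
  by_contra! hlt
  obtain ⟨t, ht, hft⟩ := intermediate_value_Icc zero_le_one hf ⟨h0.le.trans hl.le, hlt.le⟩
  linarith [hgap t ht hft.le]

/-- The solution is uniformly Lipschitz near the imaginary axis. -/
theorem norm_qveSolution_sub_le {p : ℕ} (hp : 0 < p) {S : Matrix (Fin p) (Fin p) ℝ}
    (hS : ∀ i k, 0 ≤ S i k) {c C B l δ η : ℝ} (hc : 0 < c) (hB : 0 < B) (hl : 0 < l)
    (hlc : l ≤ c / 2) (hlB : B * (l / (c / 2) ^ 3) ≤ 1 / 2) (hδ : 2 * B * δ ≤ l / 2) (hη : 0 < η)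
    {v : Fin p ⊕ Fin p → ℝ} (hv : ∀ x, c ≤ v x ∧ v x ≤ C)
    (hm : qveSolution (symmetrization S) (Complex.I * η) = fun x => Complex.I * v x)
    (hstab : ∀ h, ‖h‖ ≤ B * ‖(stabilityMatrix S fun x => Complex.I * v x).mulVec h‖) {z : ℂ}
    (hz : 0 < z.im) (hzη : ‖z - Complex.I * η‖ ≤ δ) :
    ‖qveSolution (symmetrization S) z - qveSolution (symmetrization S) (Complex.I * η)‖ ≤
      2 * B * ‖z - Complex.I * η‖ := by
  have hA := symmetrization_nonneg hS
  set z₀ : ℂ := Complex.I * η with hz₀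
  have hz₀im : 0 < z₀.im := by simpa [hz₀] using hη
  have hne : ∀ w : ℂ, 0 < w.im → w ≠ 0 := fun w hw h => by simp [h] at hw
  have key : ∀ w : ℂ, 0 < w.im →
      ‖qveSolution (symmetrization S) w - qveSolution (symmetrization S) z₀‖ ≤ l →
      ‖qveSolution (symmetrization S) w - qveSolution (symmetrization S) z₀‖ ≤
        2 * B * ‖w - z₀‖ := by
    intro w hw hwl
    have hsol := isQVESolution_qveSolution hA hw
    have hsol₀ := isQVESolution_qveSolution hA hz₀im
    -- A change of spectral parameter is read as a constant perturbation `d` of the equation at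
    -- `z₀`.
    have hg : PerturbedQVE (symmetrization S) z₀ (qveSolution (symmetrization S) w)
        fun _ => w - z₀ := fun x => by
      rw [hsol.2 x, Pi.zero_apply]
      ring
    have h1 := norm_sub_le_of_stability (a := c / 2) (by positivity) hB
      (fun x => (norm_le_two_mul_of_near (r := 0) hv (by rw [hm, sub_self, norm_zero])
        (by positivity) hc x).1)
      (fun x => (norm_le_two_mul_of_near hv (by rwa [← hm]) hlc hc x).1)
      hsol₀.2 hg ((avg_inl_eq_avg_inr_iff hp _).1 (hsol₀.avg_inl_eq_avg_inr hp (hne _ hz₀im)))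
      ((avg_inl_eq_avg_inr_iff hp _).1 (hsol.avg_inl_eq_avg_inr hp (hne _ hw)))
      (by rwa [hm]) (le_trans (by gcongr) hlB)
    refine h1.trans (mul_le_mul_of_nonneg_left ?_ (by positivity))
    exact pi_norm_const_le _
  refine key z hz ?_
  have hγim : ∀ t ∈ Set.Icc (0 : ℝ) 1, 0 < (z₀ + t * (z - z₀)).im := fun t ht => by
    simp only [Complex.add_im, Complex.im_ofReal_mul, Complex.sub_im]
    rcases ht.1.eq_or_lt with h | h
    · simpa [← h] using hz₀im
    · nlinarith [mul_pos h hz, mul_nonneg (sub_nonneg.2 ht.2) hz₀im.le]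
  -- The bound `key` needs the difference to be at most `l` already. Along the segment from `z₀` to
  -- `z` the difference starts at `0`, is continuous and cannot lie in `(l / 2, l]`, so it never
  -- exceeds `l`.
  have := le_half_of_gap (l := l) (f := fun t : ℝ =>
    ‖qveSolution (symmetrization S) (z₀ + t * (z - z₀)) - qveSolution (symmetrization S) z₀‖)
    (fun t ht => by
      have h1 : ContinuousAt (fun t : ℝ => qveSolution (symmetrization S) (z₀ + t * (z - z₀))) t :=
        ContinuousAt.comp (f := fun t : ℝ => z₀ + t * (z - z₀))
          (continuousAt_qveSolution hA (hγim t ht)) (by fun_prop)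
      exact (h1.sub continuousAt_const).norm.continuousWithinAt)
    (by simp) hl (fun t ht htl => by
      refine (key _ (hγim t ht) htl).trans (le_trans ?_ hδ)
      have h1 : ‖z₀ + t * (z - z₀) - z₀‖ ≤ δ := by
        rw [add_sub_cancel_left, norm_mul, Complex.norm_real, Real.norm_eq_abs, abs_of_nonneg ht.1]
        exact (mul_le_of_le_one_left (norm_nonneg _) ht.2).trans hzη
      gcongr)
  simpa using this

theorem tendsto_imaginaryAxis {p : ℕ} {u : ℝ → Fin p ⊕ Fin p → ℂ} {c C L r : ℝ} (hr : 0 < r)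
    (hL : 0 < L)
    (hu : ∀ η, 0 < η → η < r → ∃ v : Fin p ⊕ Fin p → ℝ, (∀ x, c ≤ v x ∧ v x ≤ C) ∧
      u η = fun x => Complex.I * v x)
    (hlip : ∀ η η', 0 < η → η < r → 0 < η' → η' < r → ‖u η - u η'‖ ≤ L * |η - η'|) :
    ∃ v₀ : Fin p ⊕ Fin p → ℝ, (∀ x, c ≤ v₀ x ∧ v₀ x ≤ C) ∧
      Tendsto u (𝓝[>] 0) (𝓝 (fun x => Complex.I * v₀ x)) := by
  have hcauchy : Cauchy (map u (𝓝[>] 0)) := by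
    refine Metric.cauchy_iff.2 ⟨inferInstance, fun e he => ?_⟩
    refine ⟨u '' Set.Ioo 0 (min r (e / L)),
      image_mem_map (Ioo_mem_nhdsGT (lt_min hr (by positivity))), ?_⟩
    rintro _ ⟨η, ⟨h1, h2⟩, rfl⟩ _ ⟨η', ⟨h3, h4⟩, rfl⟩
    rw [lt_min_iff] at h2 h4
    rw [dist_eq_norm]
    refine (hlip η η' h1 h2.1 h3 h4.1).trans_lt ?_
    rw [← lt_div_iff₀' hL, abs_lt]
    constructor <;> linarith [h2.2, h4.2]
  obtain ⟨u₀, hu₀⟩ := cauchy_map_iff_exists_tendsto.1 hcauchy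
  have hx : ∀ x, Tendsto (fun η => u η x) (𝓝[>] 0) (𝓝 (u₀ x)) := tendsto_pi_nhds.1 hu₀
  have hev : ∀ᶠ η in 𝓝[>] (0 : ℝ), ∀ x, (u η x).re = 0 ∧ c ≤ (u η x).im ∧ (u η x).im ≤ C := by
    filter_upwards [Ioo_mem_nhdsGT hr] with η hη x
    obtain ⟨v, hv, huv⟩ := hu η hη.1 hη.2
    simpa [huv] using hv x
  have hrex : ∀ x, (u₀ x).re = 0 := fun x =>
    tendsto_nhds_unique ((Complex.continuous_re.tendsto _).comp (hx x))
      (tendsto_const_nhds.congr' (hev.mono fun η hη => (hη x).1.symm))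
  refine ⟨fun x => (u₀ x).im, fun x => ⟨?_, ?_⟩, ?_⟩
  · exact ge_of_tendsto ((Complex.continuous_im.tendsto _).comp (hx x))
      (hev.mono fun η hη => (hη x).2.1)
  · exact le_of_tendsto ((Complex.continuous_im.tendsto _).comp (hx x))
      (hev.mono fun η hη => (hη x).2.2)
  · have e : u₀ = fun x => Complex.I * ((u₀ x).im : ℂ) :=
      funext fun x => by apply Complex.ext <;> simp [hrex]
    rwa [e] at hu₀

/-- All constants that enter the stability analysis near the imaginary axis. -/
theorem exists_stability_constants {s φ : ℝ} (hs : 0 < s) (hφ : 0 < φ) {K : ℕ} (hK : 0 < K) :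
    ∃ c C B l δ : ℝ, 0 < c ∧ 0 < C ∧ 0 < B ∧ 0 < l ∧ 0 < δ ∧ B * (l / (c / 2) ^ 3) ≤ 1 / 2 ∧
      l ≤ c / 2 ∧ δ ≤ 1 ∧ ∀ (p : ℕ) (S : Matrix (Fin p) (Fin p) ℝ), 0 < p →
      (∀ i k, 0 ≤ S i k) → IsFlat s S → BlockFullyIndecomposable φ K S →
      ∀ η : ℝ, 0 < η → η ≤ 10 → ∃ v : Fin p ⊕ Fin p → ℝ, (∀ x, c ≤ v x ∧ v x ≤ C) ∧
        (qveSolution (symmetrization S) (Complex.I * η) = fun x => Complex.I * v x) ∧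
        ∀ z : ℂ, 0 < z.im → ‖z - Complex.I * η‖ ≤ δ →
          ‖qveSolution (symmetrization S) z - qveSolution (symmetrization S) (Complex.I * η)‖ ≤
            B * ‖z - Complex.I * η‖ ∧
          ‖qveSolution (symmetrization S) z - fun x => Complex.I * (v x : ℂ)‖ ≤ l / 2 ∧
          ∀ h, ‖h‖ ≤ B * ‖(stabilityMatrix S (qveSolution (symmetrization S) z)).mulVec h‖ := by
  obtain ⟨c, C, B, hc, hC, hB, hmain⟩ := exists_imaginaryAxis_stability hs hφ hK
  -- The bound `l * k₁ ≤ 1` gives the absorption condition even with `2 * B` in place of `B`; `l *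
  -- k₂ ≤ 1` is the condition of `stability_of_near` at radius `l`.
  set k₁ : ℝ := 4 * B / (c / 2) ^ 3 with hk₁
  set k₂ : ℝ := 2 * B * (4 * (2 * C + c) / c ^ 4) with hk₂
  have hk₁0 : 0 < k₁ := by positivity
  have hk₂0 : 0 < k₂ := by positivity
  set l : ℝ := min (c / 2) (1 / (k₁ + k₂)) with hl
  have hl0 : 0 < l := by positivity
  have hlk : l * (k₁ + k₂) ≤ 1 := by
    rw [← le_div_iff₀ (by positivity)]
    exact min_le_right _ _
  have hlc : l ≤ c / 2 := min_le_left _ _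
  have hlk₁ : 0 ≤ l * k₁ := by positivity
  have hlk₂ : 0 ≤ l * k₂ := by positivity
  have e₁ : l * k₁ = 4 * (B * (l / (c / 2) ^ 3)) := by rw [hk₁]; ring
  have e₂ : l * k₂ = 2 * (B * (l * (4 * (2 * C + c) / c ^ 4))) := by rw [hk₂]; ring
  -- Within distance `δ` the solution moves by at most `l / 2`, which leaves the other `l / 2` for a
  -- perturbed solution `g`.
  set δ : ℝ := min 1 (l / 2 / (2 * B)) with hδ
  have hδ0 : 0 < δ := by positivity
  have hδl : 2 * B * δ ≤ l / 2 := by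
    rw [← le_div_iff₀' (by positivity)]
    exact min_le_right _ _
  refine ⟨c, C, 2 * B, l, δ, hc, hC, by positivity, hl0, hδ0, by linarith, hlc, min_le_left _ _, ?_⟩
  intro p S hp hS hflat hblock η hη hη'
  obtain ⟨v, hv, hvm, hstab⟩ := hmain p S hp hS hflat hblock η hη hη'
  refine ⟨v, hv, hvm, fun z hz hzη => ?_⟩
  have h1 := norm_qveSolution_sub_le hp hS hc hB hl0 hlc (by linarith) hδl hη hv hvm hstab hz hzη
  have h2 : ‖qveSolution (symmetrization S) z - fun x => Complex.I * (v x : ℂ)‖ ≤ l / 2 := by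
    rw [← hvm]
    refine h1.trans (le_trans ?_ hδl)
    gcongr
  exact ⟨h1, h2, stability_of_near hc hB hv hstab hl0.le hlc (by linarith) (h2.trans (by linarith))⟩

end GramQVE

/-! ### Assembly of the proposition. -/

theorem mainTheorem8 (sstar φ : ℝ) (hsstar : 0 < sstar) (hφ : 0 < φ) (K : ℕ) :
    ∃ c C δ lam : ℝ, 0 < c ∧ 0 < C ∧ 0 < δ ∧ 0 < lam ∧
      ∀ (p : ℕ) (S : Matrix (Fin p) (Fin p) ℝ), 0 < p → (∀ i k, 0 ≤ S i k) →
        IsFlat sstar S → BlockFullyIndecomposable φ K S →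
        -- the size of the solution near the imaginary axis
        (∀ z : ℂ, 0 < z.im → ‖z‖ ≤ 10 → z.re ∈ Set.Icc (-δ) δ →
          (∀ x, c ≤ ‖qveSolution (symmetrization S) z x‖ ∧
            ‖qveSolution (symmetrization S) z x‖ ≤ C) ∧
          c ≤ avg (fun x => (qveSolution (symmetrization S) z x).im)) ∧
        -- the limit at zero along the imaginary axis
        (∃ v₀ : Fin p ⊕ Fin p → ℝ, (∀ x, c ≤ v₀ x ∧ v₀ x ≤ C) ∧
          Tendsto (fun η : ℝ => qveSolution (symmetrization S) (Complex.I * η)) (𝓝[>] 0)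
            (𝓝 (fun x => Complex.I * v₀ x))) ∧
        -- stability
        ∃ T : ℂ → Matrix (Fin p ⊕ Fin p) (Fin p ⊕ Fin p) ℂ,
          (∀ z : ℂ, 0 < z.im → infOpNorm (T z) ≤ C) ∧
          ∀ d g : ℂ → Fin p ⊕ Fin p → ℂ,
            (∀ z : ℂ, 0 < z.im → ∀ x, g z x ≠ 0) →
            (∀ z : ℂ, 0 < z.im → PerturbedQVE (symmetrization S) z (g z) (d z)) →
            (∀ z : ℂ, 0 < z.im →
              avg (fun i => g z (Sum.inl i)) = avg (fun k => g z (Sum.inr k))) →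
            ∀ z : ℂ, 0 < z.im → ‖z‖ ≤ 10 → z.re ∈ Set.Icc (-δ) δ →
              ‖g z - qveSolution (symmetrization S) z‖ ≤ lam →
              ‖g z - qveSolution (symmetrization S) z‖ ≤ C * ‖d z‖ ∧
              ∀ w : Fin p ⊕ Fin p → ℂ,
                ‖scalarProd w (g z - qveSolution (symmetrization S) z)‖ ≤
                  C * (‖w‖ * ‖d z‖ ^ 2 + ‖scalarProd ((T z).mulVec w) (d z)‖) := by
  -- For `K = 0` a nonempty index set has no block map, so the claim is vacuous.
  rcases K.eq_zero_or_pos with rfl | hK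
  · refine ⟨1, 1, 1, 1, one_pos, one_pos, one_pos, one_pos, fun p S hp _ _ hblock => ?_⟩
    obtain ⟨_, b, -⟩ := hblock.exists_blockMap
    exact (b ⟨0, hp⟩).elim0
  obtain ⟨c, C, B, l, δ, hc, hC, hB, hl, hδ, hlB, hlc, hδ1, hmain⟩ :=
    exists_stability_constants hsstar hφ hK
  set a : ℝ := c / 2 with ha
  have ha0 : 0 < a := by positivity
  have hq : 0 < B * (4 * B ^ 2 / a ^ 3) := by positivity
  -- The summands dominate in turn the size of `𝔐` (`C + c`), the norm bound and `T` (`2 * B`), the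
  -- coefficient `1` of the linear term, and the quadratic term.
  refine ⟨a, C + c + 2 * B + 1 + B * (4 * B ^ 2 / a ^ 3), δ, l / 2, ha0, by positivity, hδ,
    by positivity, ?_⟩
  intro p S hp hS hflat hblock
  have hA := symmetrization_nonneg hS
  have hnear : ∀ z : ℂ, 0 < z.im → ‖z‖ ≤ 10 → z.re ∈ Set.Icc (-δ) δ →
      ∃ v : Fin p ⊕ Fin p → ℝ, (∀ x, c ≤ v x ∧ v x ≤ C) ∧
        ‖qveSolution (symmetrization S) z - fun x => Complex.I * (v x : ℂ)‖ ≤ l / 2 ∧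
        ∀ h, ‖h‖ ≤ B * ‖(stabilityMatrix S (qveSolution (symmetrization S) z)).mulVec h‖ := by
    intro z hz hz10 hre
    obtain ⟨v, hv, -, h⟩ := hmain p S hp hS hflat hblock z.im hz
      ((le_abs_self _).trans ((Complex.abs_im_le_norm z).trans hz10))
    have e : z - Complex.I * z.im = (z.re : ℂ) := by
      apply Complex.ext <;> simp
    have h1 := h z hz (by
      rw [e, Complex.norm_real, Real.norm_eq_abs]
      exact abs_le.2 hre)
    exact ⟨v, hv, h1.2⟩
  refine ⟨fun z hz hz10 hre => ?_, ?_, ?_⟩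
  · obtain ⟨v, hv, hm, -⟩ := hnear z hz hz10 hre
    have hb := norm_le_two_mul_of_near hv hm (by linarith) hc
    refine ⟨fun x => ⟨(hb x).1, (hb x).2.1.trans (by linarith)⟩, ?_⟩
    have hp' : (0 : ℝ) < p := by exact_mod_cast hp
    have hcard : (0 : ℝ) < Fintype.card (Fin p ⊕ Fin p) := by
      simp only [Fintype.card_sum, Fintype.card_fin, Nat.cast_add]
      positivity
    simp only [avg]
    rw [← div_eq_inv_mul, le_div_iff₀ hcard]
    calc a * Fintype.card (Fin p ⊕ Fin p) = ∑ x : Fin p ⊕ Fin p, a := by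
          rw [Finset.sum_const, Finset.card_univ, nsmul_eq_mul, mul_comm]
      _ ≤ _ := Finset.sum_le_sum fun x _ => (hb x).2.2.1
  · obtain ⟨v₀, hv₀, hlim⟩ := tendsto_imaginaryAxis (c := c) (C := C)
      (u := fun η : ℝ => qveSolution (symmetrization S) (Complex.I * η)) hδ hB
      (fun η hη hηδ => by
        obtain ⟨v, hv, hvm, -⟩ := hmain p S hp hS hflat hblock η hη (by linarith)
        exact ⟨v, hv, hvm⟩)
      (fun η η' hη hηδ hη' hηδ' => by
        obtain ⟨v, hv, hvm, h⟩ := hmain p S hp hS hflat hblock η' hη' (by linarith)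
        have e : ‖Complex.I * (η : ℂ) - Complex.I * η'‖ = |η - η'| := by
          rw [← mul_sub, norm_mul, Complex.norm_I, one_mul, ← Complex.ofReal_sub,
            Complex.norm_real, Real.norm_eq_abs]
        have h1 := (h (Complex.I * η) (by simpa using hη) (by
          rw [e, abs_le]
          constructor <;> linarith)).1
        rwa [e] at h1)
    exact ⟨v₀, fun x => ⟨by linarith [(hv₀ x).1], by linarith [(hv₀ x).2]⟩, hlim⟩
  -- `T z` comes from the stability matrix at `𝔐(z)` alone, before `d` and `g` are introduced.
  -- Outside the domain nothing but the norm bound is asked, and `T z = 0` serves.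
  · have hT : ∀ z : ℂ, ∃ T : Matrix (Fin p ⊕ Fin p) (Fin p ⊕ Fin p) ℂ, infOpNorm T ≤ B ∧
        (0 < z.im → ‖z‖ ≤ 10 → z.re ∈ Set.Icc (-δ) δ → ∀ w u f,
          (stabilityMatrix S (qveSolution (symmetrization S) z)).mulVec u = -f →
          scalarProd w u = scalarProd (T.mulVec w) f) := by
      intro z
      by_cases hz : 0 < z.im ∧ ‖z‖ ≤ 10 ∧ z.re ∈ Set.Icc (-δ) δ
      · obtain ⟨_, -, -, hstab⟩ := hnear z hz.1 hz.2.1 hz.2.2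
        obtain ⟨T, hT1, hT2⟩ := exists_adjoint_inverse (stabilityMatrix_transpose _) hB.le hstab
        exact ⟨T, hT1, fun _ _ _ => hT2⟩
      · exact ⟨0, infOpNorm_le hB.le fun w => by simp; positivity,
          fun h1 h2 h3 => absurd ⟨h1, h2, h3⟩ hz⟩
    choose T hT1 hT2 using hT
    refine ⟨T, fun z _ => (hT1 z).trans (by linarith), ?_⟩
    intro d g hg0 hg havg z hz hz10 hre hgl
    obtain ⟨v, hv, hm, hstab⟩ := hnear z hz hz10 hre
    set m := qveSolution (symmetrization S) z with hmdef
    have hsol : IsQVESolution (symmetrization S) z m := isQVESolution_qveSolution hA hz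
    have hma := fun x => (norm_le_two_mul_of_near hv hm (by linarith) hc x).1
    have hgv : ‖g z - fun x => Complex.I * (v x : ℂ)‖ ≤ l := by
      have := norm_sub_le_norm_sub_add_norm_sub (g z) m fun x => Complex.I * (v x : ℂ)
      linarith
    have hga := fun x => (norm_le_two_mul_of_near hv hgv hlc hc x).1
    have hms := (avg_inl_eq_avg_inr_iff hp _).1
      (hsol.avg_inl_eq_avg_inr hp fun h => by simp [h] at hz)
    have hgs := (avg_inl_eq_avg_inr_iff hp _).1 (havg z hz)
    have hsmall : B * (‖g z - m‖ / a ^ 3) ≤ 1 / 2 := by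
      refine le_trans ?_ hlB
      have : ‖g z - m‖ ≤ l := by linarith
      gcongr
    have hd := norm_sub_le_of_stability ha0 hB hma hga hsol.2 (hg z hz) hms hgs hstab hsmall
    refine ⟨hd.trans (mul_le_mul_of_nonneg_right (by linarith) (norm_nonneg _)), fun w => ?_⟩
    set ρ : Fin p ⊕ Fin p → ℂ := fun x => (g z x - m x) ^ 2 / (m x ^ 2 * g z x) with hρ
    have h1 := hT2 z hz hz10 hre w (g z - m) (d z + ρ) (funext fun x =>
      stabilityMatrix_mulVec_sub hsol.ne_zero (hg0 z hz) hsol.2 (hg z hz) hms hgs x)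
    have h2 : scalarProd ((T z).mulVec w) (d z + ρ) =
        scalarProd ((T z).mulVec w) (d z) + scalarProd ((T z).mulVec w) ρ := by
      simp only [scalarProd, Pi.add_apply, mul_add, Finset.sum_add_distrib]
    have h3 : ‖scalarProd ((T z).mulVec w) ρ‖ ≤ B * (4 * B ^ 2 / a ^ 3) * (‖w‖ * ‖d z‖ ^ 2) := by
      calc _ ≤ ‖(T z).mulVec w‖ * ‖ρ‖ := norm_scalarProd_le _ _
        _ ≤ (B * ‖w‖) * ((2 * B * ‖d z‖) ^ 2 / a ^ 3) := by
            refine mul_le_mul ((norm_mulVec_le_infOpNorm _ _).trans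
              (mul_le_mul_of_nonneg_right (hT1 z) (norm_nonneg _))) ?_ (norm_nonneg _)
              (by positivity)
            refine (norm_remainder_le ha0 hma hga).trans ?_
            gcongr
        _ = _ := by ring
    rw [h1, h2, mul_add]
    refine (norm_add_le _ _).trans ?_
    rw [add_comm]
    refine add_le_add (h3.trans (mul_le_mul_of_nonneg_right (by linarith) (by positivity))) ?_
    exact le_mul_of_one_le_left (norm_nonneg _) (by linarith)
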